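/- **Setting.** Let $n\ge 1$, let $\mathcal H_1,\dots,\mathcal H_n$ be real Hilbert spaces and put $\mathcal H_0=\mathcal H_n$. For $i=1,\dots,n$ let $A_i:\mathcal H_i\to 2^{\mathcal H_i}$ be maximal monotone, let $G_i:\mathcal H_0\to\mathcal H_i$ be linear and bounded with $G_n=I$, and let $B_i:\mathcal H_i\to\mathcal H_i$ be such that either $L_i>0$ and $\|B_ix-B_iy\|^2\le L_i\langle B_ix-B_iy,x-y\rangle$ for all $x,y$, or $L_i=0$ and $B_i$ is constant. Put $T_i=A_i+B_i$, and assume that the Kuhn–Tucker set $$\mathcal S=\Big\{(z,w_1,\dots,w_{n-1})\in\mathcal H_0\times\cdots\times\mathcal H_{n-1}:\ w_i\in T_iG_iz\ (i<n),\ -\textstyle\sum_{i<n}G_i^*w_i\in T_nz\Big\}$$ is nonempty. **One-forward step.** For $\rho>0$, $\mathcal F^i_{\rho}(z,x,w)=(x^+,y^+)$ where $t=(1-\alpha_i)x+\alpha_iG_iz-\rho(B_ix-w)$, $x^+=(I+\rho A_i)^{-1}(t)$, $y^+=\rho^{-1}(t-x^+)+B_ix^+$. **Input.** $(z^1,\mathbf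 w^1)\in\mathcal H_0\times\cdots\times\mathcal H_{n-1}$, a set $\mathcal B\subseteq\{1,\dots,n\}$, $\gamma>0$, $\delta\in(0,1)$, $\hat\rho\in\mathbb R$; for each $i$: $x_i^0\in\mathcal H_i$ and $\alpha_i\in(0,1]$; for $i\notin\mathcal B$: a stepsize $\rho_i>0$ with $\rho_i\le\hat\rho$, and $\rho_i\le 2(1-\alpha_i)/L_i$ if $L_i>0$; for $i\in\mathcal B$: $0<\rho_i^0\le\hat\rho$, points $\hat\theta_i$, $\hat w_i\in T_i\hat\theta_i$, $y_i^0\in T_ix_i^0$, and $\alpha_i<1$ if $L_i>0$. Set $\eta_i^0=0$ for $i\in\mathcal B$. **Algorithm.** Write $w_n^k=-\sum_{i<n}G_i^*w_i^k$. In iteration $k=1,2,\dots$: 1. For $i\notin\mathcal B$: $(x_i^k,y_i^k)=\mathcal F^i_{\rho_i}(z^k,x_i^{k-1},w_i^k)$. 2. For $i\in\mathcal B$ (backtracking), with $z=z^k$, $x=x_i^{k-1}$, $y=y_i^{k-1}$, $w=w_i^k$, $G=G_i$, $\alpha=\alpha_i$: put $\varphi=\langle Gz-x,y-w\rangle$ and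 choose any $\tilde\rho_1\in[\rho_i^{k-1},\min\{(1+\alpha\eta_i^{k-1})\rho_i^{k-1},\hat\rho\}]$. For $j=1,2,\dots$ compute $(\tilde x_j,\tilde y_j)=\mathcal F^i_{\tilde\rho_j}(z,x,w)$ and $\hat y_j=\tilde\rho_j^{-1}((1-\alpha)x+\alpha Gz-\tilde x_j)+w$. If $$\|\tilde x_j-\hat\theta_i\|\le(1-\alpha)\|x-\hat\theta_i\|+\alpha\|Gz-\hat\theta_i\|+\tilde\rho_j\|w-\hat w_i\|$$ and $$\langle Gz-\tilde x_j,\tilde y_j-w\rangle\ge\frac{\tilde\rho_j}{2\alpha}\big(\|\tilde y_j-w\|^2+\alpha\|\hat y_j-w\|^2\big)+(1-\alpha)\Big(\varphi-\frac{\tilde\rho_j}{2\alpha}\|y-w\|^2\Big),$$ stop with $(x_i^k,y_i^k,\rho_i^k)=(\tilde x_j,\tilde y_j,\tilde\rho_j)$ and $\eta_i^k=\|\hat y_j-w\|^2/\|\tilde y_j-w\|^2$ (any $\eta_i^k\ge0$ if $\tilde y_j=w$); otherwise put $\tilde\rho_{j+1}=\delta\tilde\rho_j$ and continue with $j+1$.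 3. Put $u_i=x_i^k-G_ix_n^k$ $(i<n)$, $v=\sum_{i<n}G_i^*y_i^k+y_n^k$, $\pi_k=\sum_{i<n}\|u_i\|^2+\gamma^{-1}\|v\|^2$. If $\pi_k=0$, terminate with final iterate $(z^{k+1},\mathbf w^{k+1})=(x_n^k,y_1^k,\dots,y_{n-1}^k)$. Otherwise put $\tau=\pi_k^{-1}\max\{0,\langle z^k,v\rangle+\sum_{i<n}\langle w_i^k,u_i\rangle-\sum_{i\le n}\langle x_i^k,y_i^k\rangle\}$, $z^{k+1}=z^k-\gamma^{-1}\tau v$, $w_i^{k+1}=w_i^k-\tau u_i$ $(i<n)$. **Theorem.** For all choices of the initial trial stepsizes: (a) in every backtracking call the interval for $\tilde\rho_1$ is nonempty and the loop over $j$ stops after finitely many trials; (b) if the algorithm terminates, its final iterate belongs to $\mathcal S$; (c) otherwise there is $(\bar z,\bar w_1,\dots,\bar w_{n-1})\in\mathcal S$ such that $(z^k,\mathbf w^k)\rightharpoonup(\bar z,\bar{\mathbf w})$ weakly in $\mathcal H_0\times\cdots\times\mathcal H_{n-1}$, and moreover $x_i^k\rightharpoonup G_i\bar z$ and $y_i^k\rightharpoonup\bar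 w_i$ for $i=1,\dots,n-1$, $x_n^k\rightharpoonup\bar z$, and $y_n^k\rightharpoonup-\sum_{i<n}G_i^*\bar w_i$. -/

import Mathlib

open Filter Topology
open scoped InnerProductSpace

namespace ProjSplit

noncomputable section

/-- A set-valued operator on a real Hilbert space is monotone. -/
def IsMonotoneOp {E : Type*} [NormedAddCommGroup E] [InnerProductSpace ℝ E]
    (A : E → Set E) : Prop :=
  ∀ x u y v, u ∈ A x → v ∈ A y → 0 ≤ ⟪x - y, u - v⟫_ℝ

/-- A maximal monotone operator: a monotone operator whose graph is not properly contained in the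
graph of another monotone operator (operators are ordered by inclusion of graphs). -/
def IsMaximalMonotone {E : Type*} [NormedAddCommGroup E] [InnerProductSpace ℝ E]
    (A : E → Set E) : Prop :=
  Maximal IsMonotoneOp A

/-- `B` is `L⁻¹`-cocoercive if `L > 0`, and constant if `L = 0`. -/
def IsCocoerciveOrConst {E : Type*} [NormedAddCommGroup E] [InnerProductSpace ℝ E]
    (L : ℝ) (B : E → E) : Prop :=
  (0 < L ∧ ∀ x y, ‖B x - B y‖ ^ 2 ≤ L * ⟪B x - B y, x - y⟫_ℝ) ∨
    (L = 0 ∧ ∃ v, ∀ x, B x = v)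

/-- Weak convergence of a sequence, that is, convergence in the weak topology. -/
def WeaklyTendsto {E : Type*} [NormedAddCommGroup E] [InnerProductSpace ℝ E]
    (u : ℕ → E) (a : E) : Prop :=
  Tendsto (fun k => toWeakSpace ℝ E (u k)) atTop (𝓝 (toWeakSpace ℝ E a))

/-- `x = J_{ρA}(t)`, where `J_{ρA} = (I + ρA)⁻¹` is the resolvent. -/
def IsResolvent {E : Type*} [NormedAddCommGroup E] [InnerProductSpace ℝ E]
    (A : E → Set E) (ρ : ℝ) (t x : E) : Prop :=
  ∃ a ∈ A x, x + ρ • a = t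

/-- `(x', y') = 𝓕_{α,ρ}(z, x, w; A, B, G)`, the one-forward-step update. -/
def IsForwardStep {E F : Type*} [NormedAddCommGroup E] [InnerProductSpace ℝ E]
    [NormedAddCommGroup F] [InnerProductSpace ℝ F]
    (A : E → Set E) (B : E → E) (G : F →L[ℝ] E) (α ρ : ℝ) (z : F) (x w x' y' : E) : Prop :=
  let t := (1 - α) • x + α • G z - ρ • (B x - w)
  IsResolvent A ρ t x' ∧ y' = ρ⁻¹ • (t - x') + B x'

/-- The point `ŷ = ρ⁻¹((1-α)x + αGz - x') + w` computed in the backtracking procedure. -/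
def yHat {E F : Type*} [NormedAddCommGroup E] [InnerProductSpace ℝ E]
    [NormedAddCommGroup F] [InnerProductSpace ℝ F]
    (G : F →L[ℝ] E) (α ρ : ℝ) (z : F) (x w x' : E) : E :=
  ρ⁻¹ • ((1 - α) • x + α • G z - x') + w

/-- The two conditions under which backtracking accepts the trial `(x', y')` for the
stepsize `ρ`. -/
def Accepts {E F : Type*} [NormedAddCommGroup E] [InnerProductSpace ℝ E]
    [NormedAddCommGroup F] [InnerProductSpace ℝ F]
    (G : F →L[ℝ] E) (α : ℝ) (θhat what : E) (z : F) (x w y : E) (ρ : ℝ) (x' y' : E) : Prop :=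
  ‖x' - θhat‖ ≤ (1 - α) * ‖x - θhat‖ + α * ‖G z - θhat‖ + ρ * ‖w - what‖ ∧
  ρ / (2 * α) * (‖y' - w‖ ^ 2 + α * ‖yHat G α ρ z x w x' - w‖ ^ 2)
      + (1 - α) * (⟪G z - x, y - w⟫_ℝ - ρ / (2 * α) * ‖y - w‖ ^ 2)
    ≤ ⟪G z - x', y' - w⟫_ℝ

section Algorithm

/- The number of operators is `n = m + 1`; the operator with index `n` is `Fin.last m`, the
operators with indices `1, …, n - 1` are `i.castSucc` for `i : Fin m`, and `H (Fin.last m)` plays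
the role of both `𝓗₀` and `𝓗ₙ`. -/
variable {m : ℕ} (H : Fin (m + 1) → Type*)
  [∀ i, NormedAddCommGroup (H i)] [∀ i, InnerProductSpace ℝ (H i)]

/-- The collective primal-dual Hilbert space `𝓗₀ × 𝓗₁ × ⋯ × 𝓗ₙ₋₁`. -/
abbrev PrimalDual : Type _ :=
  WithLp 2 (H (Fin.last m) × PiLp 2 (fun i : Fin m => H i.castSucc))

variable {H} in
/-- The point `(z, w₁, …, wₙ₋₁)` of the primal-dual space. -/
def mkPD (z : H (Fin.last m)) (w : ∀ i : Fin m, H i.castSucc) : PrimalDual H :=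
  WithLp.toLp 2 (z, WithLp.toLp 2 w)

/-- The data of the inclusion `0 ∈ ∑ i, Gᵢ* (Aᵢ + Bᵢ) Gᵢ z`. -/
structure Problem where
  A : ∀ i, H i → Set (H i)
  B : ∀ i, H i → H i
  L : Fin (m + 1) → ℝ
  G : ∀ i, H (Fin.last m) →L[ℝ] H i

variable {H}

/-- The operator `Tᵢ = Aᵢ + Bᵢ`. -/
def Problem.T (P : Problem H) (i : Fin (m + 1)) (x : H i) : Set (H i) :=
  {y | ∃ a ∈ P.A i x, y = a + P.B i x}

variable [∀ i, CompleteSpace (H i)]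

/-- `-∑_{i<n} Gᵢ* wᵢ`. -/
def Problem.lastDual (P : Problem H) (w : ∀ i : Fin m, H i.castSucc) : H (Fin.last m) :=
  -∑ i : Fin m, ContinuousLinearMap.adjoint (P.G i.castSucc) (w i)

/-- The family `(w₁, …, wₙ₋₁, wₙ)` with `wₙ = -∑_{i<n} Gᵢ* wᵢ`. -/
def Problem.fullDual (P : Problem H) (w : ∀ i : Fin m, H i.castSucc) (i : Fin (m + 1)) : H i :=
  Fin.snoc (α := H) w (P.lastDual w) i

/-- The Kuhn-Tucker (extended solution) set `𝓢`. -/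
def Problem.kuhnTucker (P : Problem H) : Set (PrimalDual H) :=
  {p | (∀ i : Fin m, p.snd i ∈ P.T i.castSucc (P.G i.castSucc p.fst)) ∧
    P.lastDual (fun i => p.snd i) ∈ P.T (Fin.last m) p.fst}

/-- The assumptions on the problem. -/
structure Problem.Standing (P : Problem H) : Prop where
  maximal : ∀ i, IsMaximalMonotone (P.A i)
  cocoercive : ∀ i, IsCocoerciveOrConst (P.L i) (P.B i)
  G_last : P.G (Fin.last m) = ContinuousLinearMap.id ℝ (H (Fin.last m))
  solvable : P.kuhnTucker.Nonempty

variable (H) in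
/-- The input of the algorithm. For `i ∈ Bt` (the operators requiring backtracking) `ρ₀ i` is the
initial stepsize `ρᵢ⁰`; for `i ∉ Bt` it is the fixed stepsize `ρᵢ`. The entries `θhat i`, `what i`,
`y₀ i` are used for `i ∈ Bt` only. -/
structure Input where
  z₁ : H (Fin.last m)
  w₁ : ∀ i : Fin m, H i.castSucc
  Bt : Set (Fin (m + 1))
  γ : ℝ
  δ : ℝ
  ρhat : ℝ
  α : Fin (m + 1) → ℝ
  ρ₀ : Fin (m + 1) → ℝ
  x₀ : ∀ i, H i
  y₀ : ∀ i, H i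
  θhat : ∀ i, H i
  what : ∀ i, H i

/-- The requirements on the input, including the stepsize assumption. -/
structure Input.Admissible (I : Input H) (P : Problem H) : Prop where
  γ_pos : 0 < I.γ
  δ_mem : I.δ ∈ Set.Ioo (0 : ℝ) 1
  α_mem : ∀ i, I.α i ∈ Set.Ioc (0 : ℝ) 1
  ρ₀_pos : ∀ i, 0 < I.ρ₀ i
  ρ₀_le_ρhat : ∀ i, I.ρ₀ i ≤ I.ρhat
  fixed_step : ∀ i ∉ I.Bt, 0 < P.L i → I.ρ₀ i ≤ 2 * (1 - I.α i) / P.L i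
  backtrack_α : ∀ i ∈ I.Bt, 0 < P.L i → I.α i < 1
  what_mem : ∀ i ∈ I.Bt, I.what i ∈ P.T i (I.θhat i)
  y₀_mem : ∀ i ∈ I.Bt, I.y₀ i ∈ P.T i (I.x₀ i)

/-- The interval from which `backTrack` chooses its first trial stepsize. -/
def Input.trialInterval (I : Input H) (i : Fin (m + 1)) (ρ η : ℝ) : Set ℝ :=
  Set.Icc ρ (min ((1 + I.α i * η) * ρ) I.ρhat)

/-- `xt j`, `yt j` is the trial pair of the pass `j = 0, 1, …` through the loop of
`backTrack(z, x, w, y, ρ, η; i)`, whose trial stepsize is `δ^j * ρ₁`. -/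
def IsTrial (P : Problem H) (I : Input H) (i : Fin (m + 1)) (z : H (Fin.last m)) (x w : H i)
    (ρ₁ : ℝ) (xt yt : ℕ → H i) (j : ℕ) : Prop :=
  IsForwardStep (P.A i) (P.B i) (P.G i) (I.α i) (I.δ ^ j * ρ₁) z x w (xt j) (yt j)

/-- The acceptance test of pass `j` of `backTrack`. -/
def TrialAccepted (P : Problem H) (I : Input H) (i : Fin (m + 1)) (z : H (Fin.last m))
    (x w y : H i) (ρ₁ : ℝ) (xt yt : ℕ → H i) (j : ℕ) : Prop :=
  Accepts (P.G i) (I.α i) (I.θhat i) (I.what i) z x w y (I.δ ^ j * ρ₁) (xt j) (yt j)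

/-- A call `backTrack(z, x, w, y, ρ, η; i)` can return `(x', y', ρ', η')`: for some choice of the
first trial stepsize `ρ₁`, the trials before pass `j` are rejected and the trial of pass `j` is
accepted. The quotient defining `η'` is undefined if `y' = w`; then any `η' ≥ 0` is allowed. -/
def BackTrackReturns (P : Problem H) (I : Input H) (i : Fin (m + 1)) (z : H (Fin.last m))
    (x w y : H i) (ρ η : ℝ) (x' y' : H i) (ρ' η' : ℝ) : Prop :=
  ∃ ρ₁ ∈ I.trialInterval i ρ η, ∃ (xt yt : ℕ → H i) (j : ℕ),
    (∀ l ≤ j, IsTrial P I i z x w ρ₁ xt yt l) ∧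
    (∀ l < j, ¬ TrialAccepted P I i z x w y ρ₁ xt yt l) ∧
    TrialAccepted P I i z x w y ρ₁ xt yt j ∧
    x' = xt j ∧ y' = yt j ∧ ρ' = I.δ ^ j * ρ₁ ∧ 0 ≤ η' ∧
    (y' ≠ w → η' = ‖yHat (P.G i) (I.α i) ρ' z x w x' - w‖ ^ 2 / ‖y' - w‖ ^ 2)

/-- A call `backTrack(z, x, w, y, ρ, η; i)` can run forever: for some choice of the first trial
stepsize all trials are rejected. -/
def BackTrackLoops (P : Problem H) (I : Input H) (i : Fin (m + 1)) (z : H (Fin.last m))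
    (x w y : H i) (ρ η : ℝ) : Prop :=
  ∃ ρ₁ ∈ I.trialInterval i ρ η, ∃ xt yt : ℕ → H i,
    ∀ j, IsTrial P I i z x w ρ₁ xt yt j ∧ ¬ TrialAccepted P I i z x w y ρ₁ xt yt j

/-- `uᵢ = xᵢ - Gᵢ xₙ` for `i = 1, …, n - 1`. -/
def Problem.u (P : Problem H) (x : ∀ i, H i) (i : Fin m) : H i.castSucc :=
  x i.castSucc - P.G i.castSucc (x (Fin.last m))

/-- `v = ∑_{i<n} Gᵢ* yᵢ + yₙ`. -/
def Problem.v (P : Problem H) (y : ∀ i, H i) : H (Fin.last m) :=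
  ∑ i : Fin m, ContinuousLinearMap.adjoint (P.G i.castSucc) (y i.castSucc) + y (Fin.last m)

/-- `π = ‖u‖² + γ⁻¹ ‖v‖²`. -/
def Problem.gradSq (P : Problem H) (γ : ℝ) (x y : ∀ i, H i) : ℝ :=
  ∑ i : Fin m, ‖P.u x i‖ ^ 2 + γ⁻¹ * ‖P.v y‖ ^ 2

/-- The affine separator `φ(z, w) = ⟨z, v⟩ + ∑_{i<n} ⟨wᵢ, uᵢ⟩ - ∑_{i≤n} ⟨xᵢ, yᵢ⟩`. -/
def Problem.separator (P : Problem H) (x y : ∀ i, H i) (z : H (Fin.last m))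
    (w : ∀ i : Fin m, H i.castSucc) : ℝ :=
  ⟪z, P.v y⟫_ℝ + ∑ i : Fin m, ⟪w i, P.u x i⟫_ℝ - ∑ i, ⟪x i, y i⟫_ℝ

/-- The projection update: `(z', w')` is the primal-dual part of the output of
`projectToHplane(z, w, {xᵢ, yᵢ})`, whose other output is `π = gradSq`. -/
def IsProjectionUpdate (P : Problem H) (γ : ℝ) (x y : ∀ i, H i)
    (z : H (Fin.last m)) (w : ∀ i : Fin m, H i.castSucc)
    (z' : H (Fin.last m)) (w' : ∀ i : Fin m, H i.castSucc) : Prop :=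
  let pi := P.gradSq γ x y
  let τ := 1 / pi * max 0 (P.separator x y z w)
  (0 < pi → z' = z - (γ⁻¹ * τ) • P.v y ∧ ∀ i, w' i = w i - τ • P.u x i) ∧
  (¬ 0 < pi → z' = x (Fin.last m) ∧ ∀ i, w' i = y i.castSucc)

variable (H) in
/-- Sequences of the algorithm. The iterates `z k = zᵏ` and `w k = wᵏ` are meaningful for `k ≥ 1`,
the others for `k ≥ 0`; `ρ k i` and `η k i` are used for backtracked operators only. -/
structure Iterates where
  z : ℕ → H (Fin.last m)
  w : ℕ → ∀ i : Fin m, H i.castSucc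
  x : ℕ → ∀ i, H i
  y : ℕ → ∀ i, H i
  ρ : ℕ → Fin (m + 1) → ℝ
  η : ℕ → Fin (m + 1) → ℝ

/-- The initialization. -/
structure Iterates.Init (s : Iterates H) (I : Input H) : Prop where
  z_one : s.z 1 = I.z₁
  w_one : s.w 1 = I.w₁
  x_zero : s.x 0 = I.x₀
  y_zero : ∀ i ∈ I.Bt, s.y 0 i = I.y₀ i
  ρ_zero : ∀ i ∈ I.Bt, s.ρ 0 i = I.ρ₀ i
  η_zero : ∀ i ∈ I.Bt, s.η 0 i = 0

/-- Iteration number `k + 1` (for `k = 0, 1, …`): it computes `xᵏ⁺¹, yᵏ⁺¹` and then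
`zᵏ⁺², wᵏ⁺²`. -/
structure Iterates.Iteration (s : Iterates H) (P : Problem H) (I : Input H) (k : ℕ) : Prop where
  backtracked : ∀ i ∈ I.Bt,
    BackTrackReturns P I i (s.z (k + 1)) (s.x k i) (P.fullDual (s.w (k + 1)) i) (s.y k i)
      (s.ρ k i) (s.η k i) (s.x (k + 1) i) (s.y (k + 1) i) (s.ρ (k + 1) i) (s.η (k + 1) i)
  fixed : ∀ i ∉ I.Bt,
    IsForwardStep (P.A i) (P.B i) (P.G i) (I.α i) (I.ρ₀ i) (s.z (k + 1)) (s.x k i)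
      (P.fullDual (s.w (k + 1)) i) (s.x (k + 1) i) (s.y (k + 1) i)
  project : IsProjectionUpdate P I.γ (s.x (k + 1)) (s.y (k + 1)) (s.z (k + 1)) (s.w (k + 1))
    (s.z (k + 2)) (s.w (k + 2))

/-- The value `π` computed in iteration number `k + 1`. -/
def Iterates.pi (s : Iterates H) (P : Problem H) (I : Input H) (k : ℕ) : ℝ :=
  P.gradSq I.γ (s.x (k + 1)) (s.y (k + 1))

/-- The iterations `1, …, K` have been performed and none of them has returned. -/
def Iterates.Continues (s : Iterates H) (P : Problem H) (I : Input H) (K : ℕ) : Prop :=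
  s.Init I ∧ ∀ k < K, s.Iteration P I k ∧ s.pi P I k ≠ 0

/-- The algorithm terminates in iteration number `K + 1`, with final iterate
`(zᴷ⁺², wᴷ⁺²)`. -/
def Iterates.ReturnsAt (s : Iterates H) (P : Problem H) (I : Input H) (K : ℕ) : Prop :=
  s.Continues P I K ∧ s.Iteration P I K ∧ s.pi P I K = 0

/-- The algorithm runs indefinitely, without terminating. -/
def Iterates.RunsForever (s : Iterates H) (P : Problem H) (I : Input H) : Prop :=
  s.Init I ∧ ∀ k, s.Iteration P I k ∧ s.pi P I k ≠ 0

end Algorithm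

end

end ProjSplit

/-! By monotonicity the affine function `separator` is nonpositive on the Kuhn–Tucker set, and the
update projects onto its half-space of nonpositivity in the norm with square `γ‖z‖² + ∑‖wᵢ‖²`. Hence
the iterates are Fejér monotone (`IsProjectionUpdate.fejer`): they are bounded and their increments
tend to zero.

The separator at the current iterate splits into terms `φᵢ = ⟪Gᵢz - xᵢ, yᵢ - wᵢ⟫`
(`separator_eq_sum`). The ascent test is a recursion with factor `1 - αᵢ` for `φᵢ - qᵢ`, where `qᵢ`
is a weighted sum of `‖yᵢ - wᵢ‖²` and `‖ŷᵢ - wᵢ‖²`; since the increments vanish, the negative part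
of `φᵢ - qᵢ` tends to zero (`StepSequence.exists_lower_bound`). The first acceptance test bounds
`xᵢ` and hence `yᵢ`, so the gradients are bounded and the positive part of the separator tends to
zero. Therefore all `qᵢ` vanish in the limit, which gives `yᵢ - wᵢ → 0` and `xᵢ - Gᵢz → 0` in norm
(`StepSequence.tendsto_of_inner`).

Weak cluster points then solve the problem by demiclosedness (`mem_T_of_innerTendsto`), and Opial's
argument yields one weak limit (`exists_innerTendsto_of_fejer`).

Backtracking stops because both tests hold once `ρL ≤ 2(1 - α)` (`IsForwardStep.accepts`); this also
keeps the stepsizes away from zero. -/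

namespace ProjSplit

/-! ### Scalar recursions with a contraction factor -/

section Sequences

theorem le_max_of_contraction {u : ℕ → ℝ} {α C : ℝ} (hα0 : 0 < α) (hα1 : α ≤ 1)
    (h : ∀ k, u (k + 1) ≤ (1 - α) * u k + α * C) (k : ℕ) : u k ≤ max (u 0) C := by
  induction k with
  | zero => exact le_max_left _ _
  | succ k ih =>
    have h1 := mul_le_mul_of_nonneg_left ih (sub_nonneg.2 hα1)
    have h2 := mul_le_mul_of_nonneg_left (le_max_right (u 0) C) hα0.le
    linarith [h k]

theorem tendsto_zero_of_contraction {b e : ℕ → ℝ} {α : ℝ} (hα0 : 0 < α) (hα1 : α ≤ 1)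
    (hb : ∀ k, 0 ≤ b k) (he : Tendsto e atTop (𝓝 0))
    (h : ∀ k, b (k + 1) ≤ (1 - α) * b k + e k) : Tendsto b atTop (𝓝 0) := by
  rw [Metric.tendsto_atTop]
  intro ε hε
  -- With errors below `α * (ε / 2)`, the value `ε / 2` is a fixed point of the bounding recursion.
  obtain ⟨N, hN⟩ := eventually_atTop.1 (he.eventually_lt_const (show (0 : ℝ) < α * (ε / 2) by positivity))
  have key : ∀ j, b (N + j) ≤ (1 - α) ^ j * b N + ε / 2 := by
    intro j
    induction j with
    | zero => simp; positivity
    | succ j ih =>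
      have h1 := mul_le_mul_of_nonneg_left ih (sub_nonneg.2 hα1)
      have h2 := h (N + j)
      have h3 := hN (N + j) (by omega)
      rw [← add_assoc, pow_succ']
      linarith
  have hlim : Tendsto (fun j => (1 - α) ^ j * b N) atTop (𝓝 0) := by
    simpa using (tendsto_pow_atTop_nhds_zero_of_lt_one (sub_nonneg.2 hα1)
      (by linarith : 1 - α < 1)).mul_const (b N)
  obtain ⟨M, hM⟩ := eventually_atTop.1 (hlim.eventually_lt_const (half_pos hε))
  refine ⟨N + M, fun n hn => ?_⟩
  obtain ⟨j, rfl⟩ := Nat.exists_eq_add_of_le (show N ≤ n by omega)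
  rw [Real.dist_eq, sub_zero, abs_of_nonneg (hb _)]
  linarith [key j, hM j (by omega)]

/-- The negative part of `a` satisfies a contraction with error `|e k|`; nothing is claimed about
the positive part. It is applied to `a = φ - q`. -/
theorem tendsto_max_neg_of_contraction {a e : ℕ → ℝ} {α : ℝ} (hα0 : 0 < α) (hα1 : α ≤ 1)
    (he : Tendsto e atTop (𝓝 0)) (h : ∀ k, (1 - α) * a k - e k ≤ a (k + 1)) :
    Tendsto (fun k => max 0 (-a k)) atTop (𝓝 0) := by
  refine tendsto_zero_of_contraction (e := fun k => |e k|) hα0 hα1 (fun k => le_max_left _ _)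
    (by simpa using he.abs) fun k => ?_
  have h0 : 0 ≤ (1 - α) * max 0 (-a k) := mul_nonneg (sub_nonneg.2 hα1) (le_max_left _ _)
  have h1 := mul_le_mul_of_nonneg_left (le_max_right 0 (-a k)) (sub_nonneg.2 hα1)
  exact max_le (by positivity) (by linarith [h k, le_abs_self (e k)])

theorem norm_le_sqrt_add {E : Type*} [NormedAddCommGroup E] {a b : E} {C : ℝ}
    (h : ‖a - b‖ ^ 2 ≤ C) : ‖a‖ ≤ √C + ‖b‖ :=
  (norm_le_norm_sub_add a b).trans (add_le_add_left (Real.le_sqrt_of_sq_le h) _)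

theorem tendsto_zero_of_norm_sq_le {E : Type*} [NormedAddCommGroup E] {u : ℕ → E} {f : ℕ → ℝ}
    (h : ∀ k, ‖u k‖ ^ 2 ≤ f k) (hf : Tendsto f atTop (𝓝 0)) : Tendsto u atTop (𝓝 0) := by
  refine squeeze_zero_norm (fun k => Real.le_sqrt_of_sq_le (h k)) ?_
  simpa [Function.comp_def] using (Real.continuous_sqrt.tendsto 0).comp hf

end Sequences

/-! ### Weak convergence in Hilbert spaces -/

section WeakLimits

variable {E : Type*} [NormedAddCommGroup E] [InnerProductSpace ℝ E]

theorem tendsto_inner_of_bounded {ι : Type*} {l : Filter ι} {u v : ι → E} {C : ℝ}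
    (hu : Tendsto u l (𝓝 0)) (hv : ∀ᶠ k in l, ‖v k‖ ≤ C) :
    Tendsto (fun k => ⟪u k, v k⟫_ℝ) l (𝓝 0) := by
  have h : Tendsto (fun k => ‖u k‖ * C) l (𝓝 0) := by simpa using hu.norm.mul_const C
  refine squeeze_zero_norm' ?_ h
  filter_upwards [hv] with k hk
  exact (norm_inner_le_norm _ _).trans (by gcongr)

theorem tendsto_sq_sub_sq {u v : ℕ → E} {C : ℝ} (h : Tendsto (fun k => u k - v k) atTop (𝓝 0))
    (hu : ∀ k, ‖u k‖ ≤ C) (hv : ∀ k, ‖v k‖ ≤ C) :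
    Tendsto (fun k => ‖u k‖ ^ 2 - ‖v k‖ ^ 2) atTop (𝓝 0) := by
  have h1 := tendsto_inner_of_bounded h (v := fun k => u k + v k) (C := C + C)
    (Eventually.of_forall fun k => (norm_add_le _ _).trans (add_le_add (hu k) (hv k)))
  refine h1.congr fun k => ?_
  rw [inner_sub_left, inner_add_right, inner_add_right, real_inner_self_eq_norm_sq,
    real_inner_self_eq_norm_sq, real_inner_comm (u k) (v k)]
  ring

variable [CompleteSpace E]

theorem weaklyTendsto_of_forall_inner {u : ℕ → E} {a : E}
    (h : ∀ d, Tendsto (fun k => ⟪u k, d⟫_ℝ) atTop (𝓝 ⟪a, d⟫_ℝ)) : WeaklyTendsto u a := by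
  have hinj : Function.Injective (topDualPairing ℝ E).flip := fun x y hxy => by
    refine ext_inner_left ℝ fun d => ?_
    simpa using LinearMap.congr_fun hxy (InnerProductSpace.toDual ℝ E d)
  refine (WeakBilin.tendsto_iff_forall_eval_tendsto _ hinj).2 fun f => ?_
  have hf : ∀ v, ⟪v, (InnerProductSpace.toDual ℝ E).symm f⟫_ℝ = f v := fun v => by
    rw [real_inner_comm, InnerProductSpace.toDual_symm_apply]
  have hlim := h ((InnerProductSpace.toDual ℝ E).symm f)
  simp only [hf] at hlim
  exact hlim

/-- Banach–Alaoglu transported by the Riesz isomorphism. Ultrafilters play the role of weakly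
convergent subsequences. -/
theorem exists_ultrafilter_weak_limit (U : Ultrafilter ℕ) {u : ℕ → E} {C : ℝ}
    (hu : ∀ᶠ k in (U : Filter ℕ), ‖u k‖ ≤ C) :
    ∃ a, ∀ h, Tendsto (fun k => ⟪u k, h⟫_ℝ) U (𝓝 ⟪a, h⟫_ℝ) := by
  let f : ℕ → WeakDual ℝ E := fun k => StrongDual.toWeakDual (InnerProductSpace.toDual ℝ E (u k))
  have hK := WeakDual.isCompact_closedBall (𝕜 := ℝ) (E := E) 0 C
  obtain ⟨g, -, hg⟩ := hK.ultrafilter_le_nhds (U.map f) (by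
    rw [le_principal_iff]
    change ∀ᶠ k in (U : Filter ℕ), _
    filter_upwards [hu] with k hk
    simpa [f] using hk)
  refine ⟨(InnerProductSpace.toDual ℝ E).symm (WeakDual.toStrongDual g), fun h => ?_⟩
  have hg' : Tendsto f U (𝓝 g) := hg
  have := (WeakDual.eval_continuous h).tendsto g |>.comp hg'
  simpa [f, Function.comp_def] using this

end WeakLimits

/-! ### Maximal monotone and cocoercive operators -/

section Monotone

variable {E : Type*} [NormedAddCommGroup E] [InnerProductSpace ℝ E]

theorem IsMaximalMonotone.mem_of_forall {A : E → Set E} (hA : IsMaximalMonotone A) {x u : E}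
    (h : ∀ θ a, a ∈ A θ → 0 ≤ ⟪x - θ, u - a⟫_ℝ) : u ∈ A x := by
  let A' : E → Set E := fun y => A y ∪ {v | y = x ∧ v = u}
  have hle : A ≤ A' := fun y => Set.subset_union_left
  have hmon : IsMonotoneOp A' := by
    rintro y v y' v' (hv | ⟨rfl, rfl⟩) (hv' | ⟨rfl, rfl⟩)
    · exact hA.prop _ _ _ _ hv hv'
    · rw [← inner_neg_neg, neg_sub, neg_sub]
      exact h _ _ hv
    · exact h _ _ hv'
    · simp
  exact hA.le_of_ge hmon hle x (Or.inr ⟨rfl, rfl⟩)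

/-- If every pairing were positive, maximality would put `(x, u)` in the graph, and pairing it with
itself gives zero. -/
theorem IsMaximalMonotone.exists_inner_nonpos {A : E → Set E} (hA : IsMaximalMonotone A)
    (x u : E) : ∃ θ, ∃ a ∈ A θ, ⟪x - θ, u - a⟫_ℝ ≤ 0 := by
  by_contra! hcon
  have := hcon x u (hA.mem_of_forall fun θ a ha => (hcon θ a ha).le)
  simp at this

/-- Minty's trick: test with `ξ = x - t • d`, divide by `t` and let `t ↓ 0`. -/
theorem eq_of_forall_inner_nonneg {B : E → E} (hB : Continuous B) {x b : E}
    (h : ∀ ξ, 0 ≤ ⟪x - ξ, b - B ξ⟫_ℝ) : b = B x := by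
  have key : ∀ d, 0 ≤ ⟪d, b - B x⟫_ℝ := by
    intro d
    have hlim : Tendsto (fun t : ℝ => ⟪d, b - B (x - t • d)⟫_ℝ) (𝓝[>] 0) (𝓝 ⟪d, b - B x⟫_ℝ) := by
      have : Continuous (fun t : ℝ => ⟪d, b - B (x - t • d)⟫_ℝ) := by fun_prop
      simpa using (this.tendsto 0).mono_left nhdsWithin_le_nhds
    refine ge_of_tendsto hlim ?_
    filter_upwards [self_mem_nhdsWithin] with t ht
    have h1 := h (x - t • d)
    rw [sub_sub_cancel, real_inner_smul_left] at h1
    exact nonneg_of_mul_nonneg_right h1 ht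
  have h1 := key (-(b - B x))
  rw [inner_neg_left, real_inner_self_eq_norm_sq] at h1
  have h2 : ‖b - B x‖ = 0 := by nlinarith [sq_nonneg ‖b - B x‖]
  exact sub_eq_zero.1 (norm_eq_zero.1 h2)

theorem IsCocoerciveOrConst.inner_nonneg {L : ℝ} {B : E → E} (hB : IsCocoerciveOrConst L B)
    (x y : E) : 0 ≤ ⟪x - y, B x - B y⟫_ℝ := by
  rcases hB with ⟨hL, h⟩ | ⟨-, v, h⟩
  · rw [real_inner_comm]
    exact nonneg_of_mul_nonneg_right ((sq_nonneg _).trans (h x y)) hL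
  · simp [h]

theorem IsCocoerciveOrConst.nonneg {L : ℝ} {B : E → E} (hB : IsCocoerciveOrConst L B) :
    0 ≤ L := by
  rcases hB with ⟨hL, -⟩ | ⟨rfl, -⟩
  exacts [hL.le, le_rfl]

theorem IsCocoerciveOrConst.sq_le {L : ℝ} {B : E → E} (hB : IsCocoerciveOrConst L B)
    (x y : E) : ‖B x - B y‖ ^ 2 ≤ L * ⟪B x - B y, x - y⟫_ℝ := by
  rcases hB with ⟨-, h⟩ | ⟨rfl, v, h⟩
  exacts [h x y, by simp [h]]

theorem IsCocoerciveOrConst.norm_le {L : ℝ} {B : E → E} (hB : IsCocoerciveOrConst L B)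
    (x y : E) : ‖B x - B y‖ ≤ L * ‖x - y‖ := by
  have h1 := hB.sq_le x y
  have h2 := mul_le_mul_of_nonneg_left (real_inner_le_norm (B x - B y) (x - y)) hB.nonneg
  rcases (norm_nonneg (B x - B y)).eq_or_lt with h0 | h0
  · rw [← h0]; exact mul_nonneg hB.nonneg (norm_nonneg _)
  · refine le_of_mul_le_mul_left ?_ h0
    nlinarith

theorem IsCocoerciveOrConst.continuous {L : ℝ} {B : E → E} (hB : IsCocoerciveOrConst L B) :
    Continuous B :=
  (LipschitzWith.of_dist_le_mul (K := ⟨L, hB.nonneg⟩) fun x y => by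
    rw [dist_eq_norm, dist_eq_norm]; exact hB.norm_le x y).continuous

end Monotone

/-- Decouples a sum: fill the other coordinates with points of nonpositive value, so that the chosen
term must carry the nonnegativity alone. -/
theorem nonneg_of_forall_sum_nonneg {ι : Type*} [Fintype ι] {C : ι → Type*} (f : ∀ i, C i → ℝ)
    (hsum : ∀ c : ∀ i, C i, 0 ≤ ∑ i, f i (c i)) (hex : ∀ i, ∃ c, f i c ≤ 0) (i : ι) (c : C i) :
    0 ≤ f i c := by
  classical
  choose d hd using hex
  have h := hsum (Function.update d i c)
  rw [← Finset.add_sum_erase _ _ (Finset.mem_univ i), Function.update_self] at h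
  have : ∑ j ∈ Finset.univ.erase i, f j (Function.update d i c j) ≤ 0 := by
    refine Finset.sum_nonpos fun j hj => ?_
    rw [Function.update_of_ne (Finset.ne_of_mem_erase hj)]
    exact hd j
  linarith

/-! ### The one-forward step and its two acceptance tests -/

section ForwardStep

variable {E F : Type*} [NormedAddCommGroup E] [InnerProductSpace ℝ E]
  [NormedAddCommGroup F] [InnerProductSpace ℝ F]
  {A : E → Set E} {B : E → E} {G : F →L[ℝ] E} {L α ρ : ℝ} {z : F} {x w y x' y' θ ω : E}

/-- One element `a` of `A x'` serves both `y'` and `ŷ`; they differ only in whether `B` is evaluated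
at `x'` or at `x`. -/
theorem IsForwardStep.exists_mem (hρ : 0 < ρ) (h : IsForwardStep A B G α ρ z x w x' y') :
    ∃ a ∈ A x', y' = a + B x' ∧ yHat G α ρ z x w x' = a + B x ∧
      x' + ρ • a = (1 - α) • x + α • G z - ρ • (B x - w) := by
  obtain ⟨⟨a, ha, hat⟩, hy⟩ := h
  refine ⟨a, ha, ?_, ?_, hat⟩
  · rw [hy, ← hat, add_sub_cancel_left, inv_smul_smul₀ hρ.ne']
  · have : (1 - α) • x + α • G z - x' = ρ • (a + B x - w) := by
      rw [eq_sub_iff_add_eq] at hat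
      rw [← hat]; module
    rw [yHat, this, inv_smul_smul₀ hρ.ne', sub_add_cancel]

/-- The trial point stays close to `θ` when the stepsize is small. -/
theorem IsForwardStep.norm_sub_le (hA : IsMonotoneOp A) (hB : IsCocoerciveOrConst L B)
    (hα0 : 0 < α) (hα1 : α ≤ 1) (hρ : 0 < ρ) (hρL : ρ * L ≤ 2 * (1 - α))
    (hω : ∃ a ∈ A θ, ω = a + B θ) (h : IsForwardStep A B G α ρ z x w x' y') :
    ‖x' - θ‖ ≤ (1 - α) * ‖x - θ‖ + α * ‖G z - θ‖ + ρ * ‖w - ω‖ := by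
  obtain ⟨a, ha, -, -, hat⟩ := h.exists_mem hρ
  obtain ⟨c, hc, rfl⟩ := hω
  have hmon := hA _ _ _ _ ha hc
  set d := (1 - α) • (x - θ) - ρ • (B x - B θ) with hd
  -- In the expansion of `‖d‖²`, cocoercivity and `ρL ≤ 2(1 - α)` let the cross term absorb `ρ²‖B x
  -- - B θ‖²`.
  have hdn : ‖d‖ ≤ (1 - α) * ‖x - θ‖ := by
    refine abs_le_of_sq_le_sq' ?_ (mul_nonneg (sub_nonneg.2 hα1) (norm_nonneg _)) |>.2
    have h1 := hB.sq_le x θ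
    have h2 : 0 ≤ ⟪B x - B θ, x - θ⟫_ℝ := by
      rw [real_inner_comm]; exact hB.inner_nonneg x θ
    have h3 := mul_le_mul_of_nonneg_left h1 (sq_nonneg ρ)
    have h4 := mul_le_mul_of_nonneg_right hρL (mul_nonneg hρ.le h2)
    rw [hd, norm_sub_sq_real, norm_smul, norm_smul, Real.norm_of_nonneg hρ.le,
      Real.norm_of_nonneg (sub_nonneg.2 hα1), real_inner_smul_left, real_inner_smul_right,
      real_inner_comm]
    linarith
  have heq : x' - θ + ρ • (a - c) = d + α • (G z - θ) + ρ • (w - (c + B θ)) := by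
    have : x' + ρ • a - (θ + ρ • c) = d + α • (G z - θ) + ρ • (w - (c + B θ)) := by
      rw [hat, hd]; module
    rw [← this]; module
  -- By monotonicity of `A`, adding `ρ • (a - c)` does not shorten `x' - θ`.
  have h1 : ‖x' - θ‖ ≤ ‖x' - θ + ρ • (a - c)‖ := by
    refine (abs_le_of_sq_le_sq' ?_ (norm_nonneg _)).2
    rw [norm_add_sq_real, real_inner_smul_right]
    nlinarith [mul_nonneg hρ.le hmon, sq_nonneg ‖ρ • (a - c)‖]
  calc _ ≤ _ := h1
    _ ≤ ‖d‖ + ‖α • (G z - θ)‖ + ‖ρ • (w - (c + B θ))‖ := by rw [heq]; exact norm_add₃_le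
    _ ≤ _ := by
      rw [norm_smul, norm_smul, Real.norm_of_nonneg hα0.le, Real.norm_of_nonneg hρ.le]
      gcongr

/-- The ascent inequality holds when the stepsize is small. -/
theorem IsForwardStep.ascent (hA : IsMonotoneOp A) (hB : IsCocoerciveOrConst L B)
    (hα0 : 0 < α) (hα1 : α ≤ 1) (hρ : 0 < ρ) (hρL : ρ * L ≤ 2 * (1 - α))
    (hy : ∃ a ∈ A x, y = a + B x) (h : IsForwardStep A B G α ρ z x w x' y') :
    ρ / (2 * α) * (‖y' - w‖ ^ 2 + α * ‖yHat G α ρ z x w x' - w‖ ^ 2)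
      + (1 - α) * (⟪G z - x, y - w⟫_ℝ - ρ / (2 * α) * ‖y - w‖ ^ 2)
    ≤ ⟪G z - x', y' - w⟫_ℝ := by
  obtain ⟨a, ha, hy', hyh, hat⟩ := h.exists_mem hρ
  rw [hyh]
  obtain ⟨c, hc, hyc⟩ := hy
  have hmon := hA _ _ _ _ ha hc
  set p := y' - w with hp
  set q := y - w with hq
  set b := B x' - B x with hb
  set d := x' - x with hd
  have hbd : ‖b‖ ^ 2 ≤ L * ⟪b, d⟫_ℝ := hB.sq_le x' x
  have hbd0 : 0 ≤ ⟪b, d⟫_ℝ := by rw [real_inner_comm]; exact hB.inner_nonneg x' x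
  have e1 : a + B x - w = p - b := by rw [hp, hy', hb]; abel
  have e2 : a - c = p - q - b := by rw [hp, hq, hy', hyc, hb]; abel
  have e3 : α • (G z - x') = ρ • (p - b) + (1 - α) • d := by
    rw [← e1, hd]
    have : α • (G z - x') = ((1 - α) • x + α • G z - ρ • (B x - w)) + ρ • (B x - w) - x'
      + (1 - α) • (x' - x) := by module
    rw [this, ← hat]; module
  rw [e1]
  rw [e2] at hmon
  have e4 : α * ⟪G z - x', p⟫_ℝ = ρ * (⟪p, p⟫_ℝ - ⟪b, p⟫_ℝ) + (1 - α) * ⟪d, p⟫_ℝ := by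
    rw [← real_inner_smul_left, e3, inner_add_left, real_inner_smul_left, real_inner_smul_left,
      inner_sub_left]
  have e5 : α * ⟪G z - x, q⟫_ℝ = ρ * (⟪p, q⟫_ℝ - ⟪b, q⟫_ℝ) + ⟪d, q⟫_ℝ := by
    have : α • (G z - x) = ρ • (p - b) + d := by
      have : α • (G z - x) = α • (G z - x') + α • (x' - x) := by module
      rw [this, e3]; module
    rw [← real_inner_smul_left, this, inner_add_left, real_inner_smul_left, inner_sub_left]
  have hpb : ‖p - b‖ ^ 2 = ⟪p, p⟫_ℝ - 2 * ⟪b, p⟫_ℝ + ‖b‖ ^ 2 := by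
    rw [norm_sub_sq_real, real_inner_self_eq_norm_sq, real_inner_comm]
  have hnn : 0 ≤ ‖p - b - q‖ ^ 2 := by positivity
  have hpbq : ‖p - b - q‖ ^ 2 = ‖p - b‖ ^ 2 - 2 * (⟪p, q⟫_ℝ - ⟪b, q⟫_ℝ) + ‖q‖ ^ 2 := by
    rw [norm_sub_sq_real, inner_sub_left]
  rw [show p - q - b = p - (q + b) by abel, inner_sub_right, inner_add_right,
    real_inner_comm b d] at hmon
  rw [← real_inner_self_eq_norm_sq p] at *
  -- Multiplied by `α`, the right side of the goal minus the left equals `(1-α)⟪d, p-q-b⟫ +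
  -- (1-α)(ρ/2)‖p-b-q‖² + ((1-α)⟪b,d⟫ - (ρ/2)‖b‖²)`. Monotonicity of `A` handles the first term, and
  -- this bound the last.
  have h2 : ρ * ‖b‖ ^ 2 ≤ 2 * (1 - α) * ⟪b, d⟫_ℝ := by
    nlinarith [mul_le_mul_of_nonneg_left hbd hρ.le, mul_le_mul_of_nonneg_right hρL hbd0]
  have h3 := mul_nonneg (mul_nonneg hρ.le (sub_nonneg.2 hα1)) (hpbq ▸ hnn)
  have h4 := mul_nonneg (sub_nonneg.2 hα1) hmon
  refine le_of_mul_le_mul_left ?_ hα0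
  have : α * (ρ / (2 * α) * (⟪p, p⟫_ℝ + α * ‖p - b‖ ^ 2)
      + (1 - α) * (⟪G z - x, q⟫_ℝ - ρ / (2 * α) * ‖q‖ ^ 2)) =
      ρ / 2 * (⟪p, p⟫_ℝ + α * ‖p - b‖ ^ 2) + (1 - α) * (α * ⟪G z - x, q⟫_ℝ)
        - (1 - α) * (ρ / 2 * ‖q‖ ^ 2) := by
    field_simp
    ring
  rw [this, e4, e5, hpb]
  rw [hpb] at h3
  nlinarith

theorem IsForwardStep.accepts (hA : IsMonotoneOp A) (hB : IsCocoerciveOrConst L B)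
    (hα0 : 0 < α) (hα1 : α ≤ 1) (hρ : 0 < ρ) (hρL : ρ * L ≤ 2 * (1 - α))
    (hω : ∃ a ∈ A θ, ω = a + B θ) (hy : ∃ a ∈ A x, y = a + B x)
    (h : IsForwardStep A B G α ρ z x w x' y') : Accepts G α θ ω z x w y ρ x' y' :=
  ⟨h.norm_sub_le hA hB hα0 hα1 hρ hρL hω, h.ascent hA hB hα0 hα1 hρ hρL hy⟩

end ForwardStep

/-! ### Asymptotics of the steps of a single operator -/

section StepSequence

variable {E F : Type*} [NormedAddCommGroup E] [InnerProductSpace ℝ E]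
  [NormedAddCommGroup F] [InnerProductSpace ℝ F]

/-- Sequences produced by repeated one-forward steps of a single operator, with stepsizes in
`[lo, hi]`, each of which passes the two acceptance tests. -/
structure StepSequence (A : E → Set E) (B : E → E) (G : F →L[ℝ] E) (L α lo hi : ℝ) (θ ω : E)
    (r : ℕ → ℝ) (z : ℕ → F) (x w y : ℕ → E) : Prop where
  α_pos : 0 < α
  α_le : α ≤ 1
  lo_pos : 0 < lo
  cocoercive : IsCocoerciveOrConst L B
  lo_le : ∀ k, lo ≤ r (k + 1)
  le_hi : ∀ k, r (k + 1) ≤ hi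
  step : ∀ k, IsForwardStep A B G α (r (k + 1)) (z (k + 1)) (x k) (w (k + 1)) (x (k + 1))
    (y (k + 1))
  bound : ∀ k, ‖x (k + 1) - θ‖ ≤ (1 - α) * ‖x k - θ‖ + α * ‖G (z (k + 1)) - θ‖
    + r (k + 1) * ‖w (k + 1) - ω‖
  -- Indices start at the second step: the first would need `y 0` to be an image of `x 0`, which is
  -- given only for backtracked operators.
  ascent : ∀ k, r (k + 2) / (2 * α) * (‖y (k + 2) - w (k + 2)‖ ^ 2
        + α * ‖yHat G α (r (k + 2)) (z (k + 2)) (x (k + 1)) (w (k + 2)) (x (k + 2))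
          - w (k + 2)‖ ^ 2)
      + (1 - α) * (⟪G (z (k + 2)) - x (k + 1), y (k + 1) - w (k + 2)⟫_ℝ
        - r (k + 2) / (2 * α) * ‖y (k + 1) - w (k + 2)‖ ^ 2)
    ≤ ⟪G (z (k + 2)) - x (k + 2), y (k + 2) - w (k + 2)⟫_ℝ
  -- This is the growth limit `(1 + αη)ρ` on the next stepsize, with the denominator of `η` cleared.
  ratio : ∀ k, r (k + 2) * ‖y (k + 1) - w (k + 1)‖ ^ 2 ≤
    r (k + 1) * (‖y (k + 1) - w (k + 1)‖ ^ 2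
        + α * ‖yHat G α (r (k + 1)) (z (k + 1)) (x k) (w (k + 1)) (x (k + 1)) - w (k + 1)‖ ^ 2)

namespace StepSequence

variable {A : E → Set E} {B : E → E} {G : F →L[ℝ] E} {L α lo hi : ℝ} {θ ω : E}
  {r : ℕ → ℝ} {z : ℕ → F} {x w y : ℕ → E}

theorem step_pos (S : StepSequence A B G L α lo hi θ ω r z x w y) (k : ℕ) : 0 < r (k + 1) :=
  S.lo_pos.trans_le (S.lo_le k)

/-- This is the purpose of the first acceptance test: distances to the fixed point `θ` obey a
contraction with bounded input. The factor `α⁻¹` in the constant compensates for the `α` in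
`le_max_of_contraction`. -/
theorem bounded_x (S : StepSequence A B G L α lo hi θ ω r z x w y) {Cz Cw : ℝ}
    (hz : ∀ k, ‖z (k + 1)‖ ≤ Cz) (hw : ∀ k, ‖w (k + 1)‖ ≤ Cw) : ∃ C, ∀ k, ‖x k‖ ≤ C := by
  have hα := S.α_pos
  have h := le_max_of_contraction (u := fun k => ‖x k - θ‖)
    (C := ‖G‖ * Cz + ‖θ‖ + α⁻¹ * (hi * (Cw + ‖ω‖))) S.α_pos S.α_le (fun k => by
      have h1 : ‖G (z (k + 1)) - θ‖ ≤ ‖G‖ * Cz + ‖θ‖ :=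
        (norm_sub_le _ _).trans (by gcongr; exact (G.le_opNorm _).trans (by gcongr; exact hz k))
      have h2 : ‖w (k + 1) - ω‖ ≤ Cw + ‖ω‖ := (norm_sub_le _ _).trans (by gcongr; exact hw k)
      have h3 := mul_le_mul (S.le_hi k) h2 (norm_nonneg _)
        ((S.step_pos k).le.trans (S.le_hi k))
      have h4 := mul_le_mul_of_nonneg_left h1 hα.le
      have h5 : α * (α⁻¹ * (hi * (Cw + ‖ω‖))) = hi * (Cw + ‖ω‖) := mul_inv_cancel_left₀ hα.ne' _
      have h6 := S.bound k
      linarith)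
  refine ⟨_, fun k => (norm_le_norm_sub_add (x k) θ).trans (add_le_add_left (h k) _)⟩

/-- `y` differs from `ŷ` by an increment of the Lipschitz map `B`, and `ŷ` is bounded because the
stepsizes stay above `lo`. -/
theorem bounded_y (S : StepSequence A B G L α lo hi θ ω r z x w y) {Cz Cw : ℝ}
    (hz : ∀ k, ‖z (k + 1)‖ ≤ Cz) (hw : ∀ k, ‖w (k + 1)‖ ≤ Cw) :
    ∃ C, ∀ k, ‖y (k + 1)‖ ≤ C := by
  obtain ⟨C, hC⟩ := S.bounded_x hz hw
  have hα0 := S.α_pos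
  have hα1 := S.α_le
  have hL := S.cocoercive.nonneg
  have hlo := S.lo_pos
  refine ⟨lo⁻¹ * ((1 - α) * C + α * (‖G‖ * Cz) + C) + Cw + L * (C + C), fun k => ?_⟩
  obtain ⟨a, ha, hy, hyh, -⟩ := (S.step k).exists_mem (S.step_pos k)
  have hrw : y (k + 1) = yHat G α (r (k + 1)) (z (k + 1)) (x k) (w (k + 1)) (x (k + 1))
      + (B (x (k + 1)) - B (x k)) := by rw [hy, hyh]; abel
  have h1 : ‖B (x (k + 1)) - B (x k)‖ ≤ L * (C + C) :=
    (S.cocoercive.norm_le _ _).trans (by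
      gcongr; exact (norm_sub_le _ _).trans (add_le_add (hC _) (hC _)))
  have h2 : ‖(1 - α) • x k + α • G (z (k + 1)) - x (k + 1)‖
      ≤ (1 - α) * C + α * (‖G‖ * Cz) + C := by
    refine (norm_sub_le _ _).trans (add_le_add ((norm_add_le _ _).trans (add_le_add ?_ ?_)) (hC _))
    · rw [norm_smul, Real.norm_of_nonneg (sub_nonneg.2 hα1)]
      exact mul_le_mul_of_nonneg_left (hC k) (sub_nonneg.2 hα1)
    · rw [norm_smul, Real.norm_of_nonneg hα0.le]
      gcongr
      exact (G.le_opNorm _).trans (by gcongr; exact hz k)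
  rw [hrw]
  refine (norm_add_le _ _).trans (add_le_add ((norm_add_le _ _).trans (add_le_add ?_ (hw k))) h1)
  rw [norm_smul, norm_inv, Real.norm_of_nonneg (S.step_pos k).le]
  exact mul_le_mul (inv_anti₀ hlo (S.lo_le k)) h2 (norm_nonneg _) (by positivity)

/-- The ascent test mixes the old `x, y` with the new `z, w`. Going back to the old `z, w` costs the
vanishing errors `ε₁` and `ε₂`, and `ratio` bounds the subtracted square by `q k`. What remains is a
contraction for `φ - q`, whose negative part serves as `ν`. -/
theorem exists_lower_bound (S : StepSequence A B G L α lo hi θ ω r z x w y) {Cz Cw : ℝ}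
    (hz : ∀ k, ‖z (k + 1)‖ ≤ Cz) (hw : ∀ k, ‖w (k + 1)‖ ≤ Cw)
    (hdz : Tendsto (fun k => z (k + 2) - z (k + 1)) atTop (𝓝 0))
    (hdw : Tendsto (fun k => w (k + 2) - w (k + 1)) atTop (𝓝 0)) :
    ∃ ν : ℕ → ℝ, Tendsto ν atTop (𝓝 0) ∧ ∀ k, 0 ≤ ν k ∧
      r (k + 1) / (2 * α) * (‖y (k + 1) - w (k + 1)‖ ^ 2
        + α * ‖yHat G α (r (k + 1)) (z (k + 1)) (x k) (w (k + 1)) (x (k + 1)) - w (k + 1)‖ ^ 2)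
      - ν k ≤ ⟪G (z (k + 1)) - x (k + 1), y (k + 1) - w (k + 1)⟫_ℝ := by
  obtain ⟨Cx, hCx⟩ := S.bounded_x hz hw
  obtain ⟨Cy, hCy⟩ := S.bounded_y hz hw
  have hα0 := S.α_pos
  have hα1 := S.α_le
  set φ : ℕ → ℝ := fun k => ⟪G (z (k + 1)) - x (k + 1), y (k + 1) - w (k + 1)⟫_ℝ with hφ
  set q : ℕ → ℝ := fun k => r (k + 1) / (2 * α) * (‖y (k + 1) - w (k + 1)‖ ^ 2
    + α * ‖yHat G α (r (k + 1)) (z (k + 1)) (x k) (w (k + 1)) (x (k + 1)) - w (k + 1)‖ ^ 2)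
    with hq
  set ε₁ : ℕ → ℝ := fun k => ⟪G (z (k + 2)) - x (k + 1), y (k + 1) - w (k + 2)⟫_ℝ - φ k with hε₁
  set ε₂ : ℕ → ℝ := fun k => ‖y (k + 1) - w (k + 2)‖ ^ 2 - ‖y (k + 1) - w (k + 1)‖ ^ 2 with hε₂
  have hdw' : Tendsto (fun k => w (k + 1) - w (k + 2)) atTop (𝓝 0) := by
    simpa using hdw.neg
  have hGx : ∀ k, ‖G (z (k + 1)) - x (k + 1)‖ ≤ ‖G‖ * Cz + Cx := fun k =>
    (norm_sub_le _ _).trans (add_le_add ((G.le_opNorm _).trans (by gcongr; exact hz k)) (hCx _))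
  have hyw : ∀ k l, ‖y (k + 1) - w (l + 1)‖ ≤ Cy + Cw := fun k l =>
    (norm_sub_le _ _).trans (add_le_add (hCy k) (hw l))
  have t1 : Tendsto ε₁ atTop (𝓝 0) := by
    have hG : Tendsto (fun k => G (z (k + 2) - z (k + 1))) atTop (𝓝 0) := by
      have := (G.continuous.tendsto 0).comp hdz
      rwa [map_zero] at this
    have h1 := tendsto_inner_of_bounded hG (v := fun k => y (k + 1) - w (k + 2))
      (Eventually.of_forall fun k => hyw k (k + 1))
    have h2 := tendsto_inner_of_bounded hdw' (Eventually.of_forall hGx)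
    have h3 := h1.add h2
    rw [add_zero] at h3
    refine h3.congr fun k => ?_
    rw [hε₁, hφ]
    simp only
    rw [real_inner_comm _ (w (k + 1) - w (k + 2)), map_sub]
    simp only [inner_sub_left, inner_sub_right]
    ring
  have t2 : Tendsto ε₂ atTop (𝓝 0) :=
    tendsto_sq_sub_sq (hdw'.congr fun k => by abel) (fun k => hyw k (k + 1)) (fun k => hyw k k)
  have t3 : Tendsto (fun k => r (k + 2) / (2 * α) * ε₂ k) atTop (𝓝 0) := by
    refine squeeze_zero_norm (a := fun k => hi / (2 * α) * |ε₂ k|) (fun k => ?_)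
      (by simpa using t2.abs.const_mul (hi / (2 * α)))
    have h0 := S.step_pos (k + 1)
    have h1 := S.le_hi (k + 1)
    rw [norm_mul, Real.norm_of_nonneg (by positivity), Real.norm_eq_abs]
    gcongr
  refine ⟨fun k => max 0 (-(φ k - q k)), ?_, fun k => ⟨le_max_left _ _, ?_⟩⟩
  · refine tendsto_max_neg_of_contraction (a := fun k => φ k - q k)
      (e := fun k => -((1 - α) * (ε₁ k - r (k + 2) / (2 * α) * ε₂ k))) hα0 hα1
      (by simpa using ((t1.sub t3).const_mul (1 - α)).neg) fun k => ?_
    have h1 := S.ascent k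
    have h2 : r (k + 2) / (2 * α) * ‖y (k + 1) - w (k + 1)‖ ^ 2 ≤ q k := by
      have := mul_le_mul_of_nonneg_right (S.ratio k) (show 0 ≤ (2 * α)⁻¹ by positivity)
      rw [hq, div_mul_eq_mul_div, div_eq_mul_inv]
      simp only
      rw [div_mul_eq_mul_div, div_eq_mul_inv]
      exact this
    have h3 := mul_le_mul_of_nonneg_left h2 (sub_nonneg.2 hα1)
    have e1 : ⟪G (z (k + 2)) - x (k + 1), y (k + 1) - w (k + 2)⟫_ℝ = φ k + ε₁ k := by
      rw [hε₁]; ring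
    have e2 : ‖y (k + 1) - w (k + 2)‖ ^ 2 = ‖y (k + 1) - w (k + 1)‖ ^ 2 + ε₂ k := by
      rw [hε₂]; ring
    rw [e1, e2] at h1
    have h4 : q (k + 1) + (1 - α) * (φ k + ε₁ k - r (k + 2) / (2 * α) *
      (‖y (k + 1) - w (k + 1)‖ ^ 2 + ε₂ k)) ≤ φ (k + 1) := h1
    linarith
  · have := le_max_right 0 (-(φ k - q k))
    change q k - max 0 (-(φ k - q k)) ≤ φ k
    linarith

/-- Vanishing squares give `y - w → 0` and `ŷ - w → 0`. By definition of `ŷ`, the latter says that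
the new `x` is nearly `(1-α)x + αGz`, so `x - Gz` contracts up to vanishing errors. -/
theorem tendsto_of_inner (S : StepSequence A B G L α lo hi θ ω r z x w y) {ν : ℕ → ℝ}
    (hdz : Tendsto (fun k => z (k + 2) - z (k + 1)) atTop (𝓝 0))
    (hν : Tendsto ν atTop (𝓝 0))
    (hle : ∀ k, r (k + 1) / (2 * α) * (‖y (k + 1) - w (k + 1)‖ ^ 2
        + α * ‖yHat G α (r (k + 1)) (z (k + 1)) (x k) (w (k + 1)) (x (k + 1)) - w (k + 1)‖ ^ 2)
      ≤ ν k) :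
    Tendsto (fun k => y (k + 1) - w (k + 1)) atTop (𝓝 0) ∧
      Tendsto (fun k => x (k + 1) - G (z (k + 1))) atTop (𝓝 0) := by
  have hα0 := S.α_pos
  have hα1 := S.α_le
  have hlo := S.lo_pos
  set e : ℕ → E := fun k =>
    yHat G α (r (k + 1)) (z (k + 1)) (x k) (w (k + 1)) (x (k + 1)) - w (k + 1) with he
  have hsum : ∀ k, ‖y (k + 1) - w (k + 1)‖ ^ 2 + α * ‖e k‖ ^ 2 ≤ 2 * α / lo * ν k := by
    intro k
    have h1 : lo / (2 * α) * (‖y (k + 1) - w (k + 1)‖ ^ 2 + α * ‖e k‖ ^ 2) ≤ ν k := by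
      refine le_trans ?_ (hle k)
      have := S.lo_le k
      gcongr
    rw [div_mul_eq_mul_div, div_le_iff₀ (by positivity)] at h1
    rw [div_mul_eq_mul_div, le_div_iff₀ hlo]
    linarith
  have hy : Tendsto (fun k => y (k + 1) - w (k + 1)) atTop (𝓝 0) :=
    tendsto_zero_of_norm_sq_le
      (fun k => (le_add_of_nonneg_right (by positivity)).trans (hsum k))
      (by simpa using hν.const_mul (2 * α / lo))
  have hezero : Tendsto e atTop (𝓝 0) := by
    refine tendsto_zero_of_norm_sq_le (f := fun k => α⁻¹ * (2 * α / lo) * ν k) (fun k => ?_)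
      (by simpa using hν.const_mul (α⁻¹ * (2 * α / lo)))
    rw [mul_assoc, inv_mul_eq_div, le_div_iff₀ hα0, mul_comm]
    exact (le_add_of_nonneg_left (by positivity)).trans (hsum k)
  refine ⟨hy, ?_⟩
  have hre : Tendsto (fun k => hi * ‖e (k + 1)‖) atTop (𝓝 0) := by
    simpa using ((tendsto_add_atTop_iff_nat 1).2 hezero).norm.const_mul hi
  have hG : Tendsto (fun k => ‖G (z (k + 2) - z (k + 1))‖) atTop (𝓝 0) := by
    simpa using ((G.continuous.tendsto 0).comp hdz).norm
  rw [tendsto_zero_iff_norm_tendsto_zero]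
  refine tendsto_zero_of_contraction
    (e := fun k => ‖G (z (k + 2) - z (k + 1))‖ + hi * ‖e (k + 1)‖) hα0 hα1 (fun k => norm_nonneg _)
    (by simpa using hG.add hre) fun k => ?_
  have hr := S.step_pos (k + 1)
  have heq : (1 - α) • x (k + 1) + α • G (z (k + 2)) - x (k + 2) = r (k + 2) • e (k + 1) := by
    rw [he]
    simp only [yHat, add_sub_cancel_right]
    rw [smul_inv_smul₀ hr.ne']
  have heq2 : x (k + 2) - G (z (k + 2)) = (1 - α) • (x (k + 1) - G (z (k + 1)))
      - ((1 - α) • G (z (k + 2) - z (k + 1)) + r (k + 2) • e (k + 1)) := by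
    rw [← heq, map_sub]; module
  have h1 : ‖(1 - α) • (x (k + 1) - G (z (k + 1)))‖ = (1 - α) * ‖x (k + 1) - G (z (k + 1))‖ := by
    rw [norm_smul, Real.norm_of_nonneg (sub_nonneg.2 hα1)]
  have h2 : ‖(1 - α) • G (z (k + 2) - z (k + 1))‖ ≤ ‖G (z (k + 2) - z (k + 1))‖ := by
    rw [norm_smul, Real.norm_of_nonneg (sub_nonneg.2 hα1)]
    exact mul_le_of_le_one_left (norm_nonneg _) (by linarith)
  have h3 : ‖r (k + 2) • e (k + 1)‖ ≤ hi * ‖e (k + 1)‖ := by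
    rw [norm_smul, Real.norm_of_nonneg hr.le]
    gcongr
    exact S.le_hi (k + 1)
  change ‖x (k + 2) - G (z (k + 2))‖ ≤ _
  rw [heq2, ← h1]
  exact (norm_sub_le _ _).trans (by gcongr; exact (norm_add_le _ _).trans (add_le_add h2 h3))

end StepSequence

end StepSequence

/-! ### Convergence tested by inner products -/

/-- Convergence of `u` to `a` along `l` when tested against every vector by the inner product. -/
def InnerTendsto {E : Type*} [NormedAddCommGroup E] [InnerProductSpace ℝ E] (l : Filter ℕ)
    (u : ℕ → E) (a : E) : Prop :=
  ∀ h, Tendsto (fun k => ⟪u k, h⟫_ℝ) l (𝓝 ⟪a, h⟫_ℝ)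

section InnerTendsto

variable {E F : Type*} [NormedAddCommGroup E] [InnerProductSpace ℝ E]
  [NormedAddCommGroup F] [InnerProductSpace ℝ F] {l : Filter ℕ} {u v : ℕ → E} {a b : E}

theorem InnerTendsto.of_sub (hv : InnerTendsto l v a) (h : Tendsto (fun k => u k - v k) l (𝓝 0)) :
    InnerTendsto l u a := fun d => by
  have h1 := (h.inner (tendsto_const_nhds (x := d))).add (hv d)
  rw [inner_zero_left, zero_add] at h1
  exact h1.congr fun k => by rw [inner_sub_left]; ring

theorem InnerTendsto.sub (hu : InnerTendsto l u a) (hv : InnerTendsto l v b) :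
    InnerTendsto l (fun k => u k - v k) (a - b) := fun d => by
  simpa only [inner_sub_left] using (hu d).sub (hv d)

theorem InnerTendsto.map [CompleteSpace E] [CompleteSpace F] (hu : InnerTendsto l u a)
    (G : E →L[ℝ] F) : InnerTendsto l (fun k => G (u k)) (G a) := fun d => by
  simpa only [ContinuousLinearMap.adjoint_inner_right] using
    hu (ContinuousLinearMap.adjoint G d)

theorem InnerTendsto.weaklyTendsto [CompleteSpace E]
    (h : InnerTendsto atTop (fun k => u (k + 1)) a) :
    WeaklyTendsto u a :=
  weaklyTendsto_of_forall_inner fun d =>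
    (tendsto_add_atTop_iff_nat (f := fun k => ⟪u k, d⟫_ℝ) 1).1 (h d)

end InnerTendsto

/-! ### The separator and the Kuhn–Tucker set -/

section Separator

variable {m : ℕ} {H : Fin (m + 1) → Type*}
  [∀ i, NormedAddCommGroup (H i)] [∀ i, InnerProductSpace ℝ (H i)]

theorem InnerTendsto.mkPD {l : Filter ℕ} {z : ℕ → H (Fin.last m)}
    {w : ℕ → ∀ i : Fin m, H i.castSucc} {zbar : H (Fin.last m)}
    {wbar : ∀ i : Fin m, H i.castSucc} (hz : InnerTendsto l z zbar)
    (hw : ∀ i, InnerTendsto l (fun k => w k i) (wbar i)) :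
    InnerTendsto l (fun k => ProjSplit.mkPD (z k) (w k)) (ProjSplit.mkPD zbar wbar) := fun d => by
  simp only [ProjSplit.mkPD, WithLp.prod_inner_apply, PiLp.inner_apply]
  exact (hz _).add (tendsto_finsetSum _ fun i _ => hw i _)

variable [∀ i, CompleteSpace (H i)]

namespace Problem

variable {P : Problem H}

@[simp]
theorem fullDual_castSucc (w : ∀ i : Fin m, H i.castSucc) (i : Fin m) :
    P.fullDual w i.castSucc = w i := by
  simp [fullDual]

@[simp]
theorem fullDual_last (w : ∀ i : Fin m, H i.castSucc) :
    P.fullDual w (Fin.last m) = P.lastDual w := by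
  simp [fullDual]

theorem mkPD_mem_kuhnTucker (hP : P.Standing) (z : H (Fin.last m))
    (w : ∀ i : Fin m, H i.castSucc) :
    mkPD z w ∈ P.kuhnTucker ↔ ∀ i, P.fullDual w i ∈ P.T i (P.G i z) := by
  rw [Fin.forall_fin_succ']
  simp [kuhnTucker, mkPD, hP.G_last]

theorem sum_inner_fullDual (hP : P.Standing) (z : H (Fin.last m))
    (w : ∀ i : Fin m, H i.castSucc) : ∑ i, ⟪P.G i z, P.fullDual w i⟫_ℝ = 0 := by
  rw [Fin.sum_univ_castSucc]
  simp [lastDual, hP.G_last, inner_sum, ContinuousLinearMap.adjoint_inner_right]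

/-- The choice of the last dual variable makes `∑ ⟪Gᵢz, wᵢ⟫` vanish, so the separator splits into
one term per operator. -/
theorem separator_eq_sum (hP : P.Standing) (x y : ∀ i, H i) (z : H (Fin.last m))
    (w : ∀ i : Fin m, H i.castSucc) :
    P.separator x y z w = ∑ i, ⟪P.G i z - x i, y i - P.fullDual w i⟫_ℝ := by
  have h1 : ∑ i, ⟪P.G i z, y i⟫_ℝ = ⟪z, P.v y⟫_ℝ := by
    rw [Fin.sum_univ_castSucc]
    simp [v, hP.G_last, inner_sum, inner_add_right, ContinuousLinearMap.adjoint_inner_right]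
  have h2 : ∑ i, ⟪x i, P.fullDual w i⟫_ℝ = ∑ i : Fin m, ⟪w i, P.u x i⟫_ℝ := by
    rw [Fin.sum_univ_castSucc]
    simp only [fullDual_castSucc, fullDual_last, lastDual, u, inner_neg_right, inner_sum,
      ContinuousLinearMap.adjoint_inner_right, inner_sub_right, Finset.sum_sub_distrib]
    simp only [real_inner_comm]
    ring
  have h3 := sum_inner_fullDual hP z w
  simp only [inner_sub_left, inner_sub_right, Finset.sum_sub_distrib]
  rw [h1, h2, h3, separator]
  ring

theorem inner_nonneg_of_mem_T (hP : P.Standing) {i : Fin (m + 1)} {x x' y y' : H i}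
    (h : y ∈ P.T i x) (h' : y' ∈ P.T i x') : 0 ≤ ⟪x - x', y - y'⟫_ℝ := by
  obtain ⟨a, ha, rfl⟩ := h
  obtain ⟨b, hb, rfl⟩ := h'
  rw [add_sub_add_comm, inner_add_right]
  exact add_nonneg ((hP.maximal i).prop _ _ _ _ ha hb) ((hP.cocoercive i).inner_nonneg _ _)

theorem separator_nonpos (hP : P.Standing) {x y : ∀ i, H i} {z : H (Fin.last m)}
    {w : ∀ i : Fin m, H i.castSucc} (hy : ∀ i, y i ∈ P.T i (x i))
    (hzw : ∀ i, P.fullDual w i ∈ P.T i (P.G i z)) : P.separator x y z w ≤ 0 := by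
  rw [separator_eq_sum hP]
  refine Finset.sum_nonpos fun i _ => ?_
  have := inner_nonneg_of_mem_T hP (hzw i) (hy i)
  rw [← neg_sub (P.fullDual w i), inner_neg_right]
  linarith

theorem fullDual_sub (w w' : ∀ i : Fin m, H i.castSucc) (i : Fin (m + 1)) :
    P.fullDual w i - P.fullDual w' i = P.fullDual (fun j => w j - w' j) i := by
  refine Fin.lastCases ?_ (fun j => ?_) i
  · simp [lastDual, Finset.sum_sub_distrib]
    abel
  · simp

theorem tendsto_fullDual {w : ℕ → ∀ i : Fin m, H i.castSucc}
    (h : ∀ i, Tendsto (fun k => w k i) atTop (𝓝 0)) (i : Fin (m + 1)) :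
    Tendsto (fun k => P.fullDual (w k) i) atTop (𝓝 0) := by
  refine Fin.lastCases ?_ (fun j => ?_) i
  · simp only [fullDual_last, lastDual]
    rw [← neg_zero]
    refine Tendsto.neg ?_
    rw [← Finset.sum_const_zero (s := (Finset.univ : Finset (Fin m)))]
    refine tendsto_finsetSum _ fun j _ => ?_
    have := ((ContinuousLinearMap.adjoint (P.G j.castSucc)).continuous.tendsto 0).comp (h j)
    rwa [map_zero] at this
  · simpa using h j

theorem bounded_fullDual {w : ℕ → ∀ i : Fin m, H i.castSucc}
    (h : ∀ i, ∃ C, ∀ k, ‖w k i‖ ≤ C) (i : Fin (m + 1)) : ∃ C, ∀ k, ‖P.fullDual (w k) i‖ ≤ C := by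
  refine Fin.lastCases ?_ (fun j => ?_) i
  · choose C hC using h
    refine ⟨∑ j, ‖ContinuousLinearMap.adjoint (P.G j.castSucc)‖ * C j, fun k => ?_⟩
    rw [fullDual_last, lastDual, norm_neg]
    refine norm_sum_le_of_le _ fun j _ => ?_
    exact (ContinuousLinearMap.le_opNorm _ _).trans (by gcongr; exact hC j k)
  · simpa using h j

theorem innerTendsto_fullDual {l : Filter ℕ} {w : ℕ → ∀ i : Fin m, H i.castSucc}
    {wbar : ∀ i : Fin m, H i.castSucc} (h : ∀ i, InnerTendsto l (fun k => w k i) (wbar i))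
    (i : Fin (m + 1)) : InnerTendsto l (fun k => P.fullDual (w k) i) (P.fullDual wbar i) := by
  refine Fin.lastCases ?_ (fun j => ?_) i
  · intro d
    simp only [fullDual_last, lastDual, inner_neg_left, sum_inner]
    exact (tendsto_finsetSum _ fun j _ => (h j).map _ d).neg
  · simpa using h j

theorem gradSq_nonneg {γ : ℝ} (hγ : 0 < γ) (x y : ∀ i, H i) : 0 ≤ P.gradSq γ x y := by
  unfold gradSq; positivity

theorem bounded_gradSq {γ : ℝ} (hγ : 0 < γ) {x y : ℕ → ∀ i, H i}
    (hx : ∀ i, ∃ C, ∀ k, ‖x k i‖ ≤ C) (hy : ∀ i, ∃ C, ∀ k, ‖y k i‖ ≤ C) :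
    ∃ C, ∀ k, P.gradSq γ (x k) (y k) ≤ C := by
  choose Cx hCx using hx
  choose Cy hCy using hy
  refine ⟨∑ i : Fin m, (Cx i.castSucc + ‖P.G i.castSucc‖ * Cx (Fin.last m)) ^ 2 + γ⁻¹ *
    (∑ i : Fin m, ‖ContinuousLinearMap.adjoint (P.G i.castSucc)‖ * Cy i.castSucc
      + Cy (Fin.last m)) ^ 2, fun k => ?_⟩
  unfold gradSq
  refine add_le_add (Finset.sum_le_sum fun i _ => ?_) (mul_le_mul_of_nonneg_left ?_ (by positivity))
  all_goals refine pow_le_pow_left₀ (norm_nonneg _) ?_ 2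
  · exact (norm_sub_le _ _).trans (add_le_add (hCx _ _)
      ((ContinuousLinearMap.le_opNorm _ _).trans (by gcongr; exact hCx _ _)))
  · refine (norm_add_le _ _).trans (add_le_add (norm_sum_le_of_le _ fun j _ => ?_) (hCy _ _))
    exact (ContinuousLinearMap.le_opNorm _ _).trans (by gcongr; exact hCy _ _)

theorem mem_kuhnTucker_of_gradSq_eq_zero (hP : P.Standing) {γ : ℝ} (hγ : 0 < γ) {x y : ∀ i, H i}
    (hy : ∀ i, y i ∈ P.T i (x i)) (h : P.gradSq γ x y = 0) :
    mkPD (x (Fin.last m)) (fun i => y i.castSucc) ∈ P.kuhnTucker := by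
  have h1 : 0 ≤ ∑ i : Fin m, ‖P.u x i‖ ^ 2 := by positivity
  have h2 : 0 ≤ γ⁻¹ * ‖P.v y‖ ^ 2 := by positivity
  unfold gradSq at h
  have hv : P.v y = 0 := by
    have : γ⁻¹ * ‖P.v y‖ ^ 2 = 0 := by linarith
    simpa [hγ.ne'] using this
  have hu : ∀ i : Fin m, x i.castSucc = P.G i.castSucc (x (Fin.last m)) := fun i => by
    have : ∑ i : Fin m, ‖P.u x i‖ ^ 2 = 0 := by linarith
    have := (Finset.sum_eq_zero_iff_of_nonneg fun _ _ => by positivity).1 this i (Finset.mem_univ _)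
    simpa [u, sub_eq_zero] using this
  rw [mkPD_mem_kuhnTucker hP, Fin.forall_fin_succ']
  refine ⟨fun i => ?_, ?_⟩
  · rw [fullDual_castSucc, ← hu]
    exact hy _
  · rw [fullDual_last, hP.G_last, lastDual, neg_eq_of_add_eq_zero_right hv]
    exact hy _

/-- A demiclosedness principle for the Kuhn-Tucker set. -/
theorem mem_T_of_innerTendsto (hP : P.Standing) {U : Ultrafilter ℕ} (hU : (U : Filter ℕ) ≤ atTop)
    {x y : ℕ → ∀ i, H i} {z : ℕ → H (Fin.last m)} {w : ℕ → ∀ i : Fin m, H i.castSucc}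
    {zbar : H (Fin.last m)} {wbar : ∀ i : Fin m, H i.castSucc}
    (hy : ∀ k i, y k i ∈ P.T i (x k i))
    (hxb : ∀ i, ∃ C, ∀ k, ‖x k i‖ ≤ C) (hyb : ∀ i, ∃ C, ∀ k, ‖y k i‖ ≤ C)
    (hzb : ∃ C, ∀ k, ‖z k‖ ≤ C)
    (hxz : ∀ i, Tendsto (fun k => x k i - P.G i (z k)) atTop (𝓝 0))
    (hyw : ∀ i, Tendsto (fun k => y k i - P.fullDual (w k) i) atTop (𝓝 0))
    (hz : InnerTendsto U z zbar) (hw : ∀ i, InnerTendsto U (fun k => w k i) (wbar i))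
    (i : Fin (m + 1)) : P.fullDual wbar i ∈ P.T i (P.G i zbar) := by
  have hxlim : ∀ i, InnerTendsto U (fun k => x k i) (P.G i zbar) := fun i =>
    (hz.map (P.G i)).of_sub ((hxz i).mono_left hU)
  have hylim : ∀ i, InnerTendsto U (fun k => y k i) (P.fullDual wbar i) := fun i =>
    (innerTendsto_fullDual hw i).of_sub ((hyw i).mono_left hU)
  -- `B` need not be weakly continuous, so its values only have some limit `b` along `U`, identified
  -- at the end.
  have hBlim : ∀ i, ∃ b, InnerTendsto U (fun k => P.B i (x k i)) b := fun i => by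
    obtain ⟨C, hC⟩ := hxb i
    have hL := (hP.cocoercive i).nonneg
    refine exists_ultrafilter_weak_limit U (C := P.L i * C + ‖P.B i 0‖)
      (Eventually.of_forall fun k => ?_)
    refine (norm_le_norm_sub_add _ (P.B i 0)).trans (add_le_add_left ?_ _)
    refine ((hP.cocoercive i).norm_le _ _).trans ?_
    rw [sub_zero]
    gcongr
    exact hC k
  choose b hb using hBlim
  -- The products `⟪xᵢ, yᵢ⟫` need not converge to the product of the limits one by one. Their sum
  -- does: it is asymptotic to `∑ ⟪Gᵢz, wᵢ⟫ = 0`.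
  have hsum : Tendsto (fun k => ∑ i, ⟪x k i, y k i⟫_ℝ) U
      (𝓝 (∑ i, ⟪P.G i zbar, P.fullDual wbar i⟫_ℝ)) := by
    rw [sum_inner_fullDual hP]
    refine Tendsto.mono_left ?_ hU
    obtain ⟨Cz, hCz⟩ := hzb
    have h1 : Tendsto (fun k => ∑ i, (⟪x k i - P.G i (z k), y k i⟫_ℝ
        + ⟪y k i - P.fullDual (w k) i, P.G i (z k)⟫_ℝ)) atTop (𝓝 (∑ i : Fin (m + 1), (0 + 0))) := by
      refine tendsto_finsetSum _ fun i _ => ?_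
      obtain ⟨Cy, hCy⟩ := hyb i
      refine (tendsto_inner_of_bounded (hxz i) (Eventually.of_forall hCy)).add
        (tendsto_inner_of_bounded (C := ‖P.G i‖ * Cz) (hyw i) (Eventually.of_forall fun k => ?_))
      exact (ContinuousLinearMap.le_opNorm _ _).trans (by gcongr; exact hCz k)
    simp only [add_zero, Finset.sum_const_zero] at h1
    refine h1.congr fun k => ?_
    refine Eq.trans ?_ (sub_zero (∑ i, ⟪x k i, y k i⟫_ℝ))
    rw [← sum_inner_fullDual hP (z k) (w k), ← Finset.sum_sub_distrib]
    refine Finset.sum_congr rfl fun i _ => ?_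
    simp only [inner_sub_left, inner_sub_right, real_inner_comm (P.G i (z k))]
    ring
  -- The test points for `A i` and for `B i` are independent, so that both inclusions can be
  -- recovered separately.
  let f : ∀ i, {p : H i × H i // p.2 ∈ P.A i p.1} × H i → ℝ := fun i c =>
    ⟪P.G i zbar - c.1.1.1, P.fullDual wbar i - b i - c.1.1.2⟫_ℝ
      + ⟪P.G i zbar - c.2, b i - P.B i c.2⟫_ℝ
  have hfsum : ∀ c : ∀ i, {p : H i × H i // p.2 ∈ P.A i p.1} × H i, 0 ≤ ∑ i, f i (c i) := by
    intro c
    have hlim : Tendsto (fun k => ∑ i, (⟪x k i - (c i).1.1.1, y k i - P.B i (x k i) - (c i).1.1.2⟫_ℝ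
      + ⟪x k i - (c i).2, P.B i (x k i) - P.B i (c i).2⟫_ℝ)) U (𝓝 (∑ i, f i (c i))) := by
      -- The limit `b` cancels from the quadratic part: the only product of two varying sequences
      -- left is `⟪X, Y⟫`, covered by `hsum`.
      have expand : ∀ (i : Fin (m + 1)) (X Y β θ a ξ d : H i),
          ⟪X - θ, Y - β - a⟫_ℝ + ⟪X - ξ, β - d⟫_ℝ = ⟪X, Y⟫_ℝ + (-⟪X, a⟫_ℝ - ⟪Y - β, θ⟫_ℝ + ⟪θ, a⟫_ℝ
            - ⟪X, d⟫_ℝ - ⟪β, ξ⟫_ℝ + ⟪ξ, d⟫_ℝ) := by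
        intro i X Y β θ a ξ d
        simp only [inner_sub_left, inner_sub_right, real_inner_comm Y θ, real_inner_comm β θ,
          real_inner_comm β ξ]
        ring
      simp only [f, expand, Finset.sum_add_distrib (f := fun i => ⟪_, _⟫_ℝ)]
      refine hsum.add (tendsto_finsetSum _ fun i _ => ?_)
      refine Tendsto.add (Tendsto.sub (Tendsto.sub (Tendsto.add (Tendsto.sub (Tendsto.neg ?_) ?_) ?_)
        ?_) ?_) ?_
      · exact hxlim i _
      · exact (hylim i).sub (hb i) _
      · exact tendsto_const_nhds
      · exact hxlim i _
      · exact hb i _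
      · exact tendsto_const_nhds
    refine ge_of_tendsto' hlim fun k => Finset.sum_nonneg fun i _ => add_nonneg ?_ ?_
    · obtain ⟨a, ha, hya⟩ := hy k i
      rw [hya, add_sub_cancel_right]
      exact (hP.maximal i).prop _ _ _ _ ha (c i).1.2
    · exact (hP.cocoercive i).inner_nonneg _ _
  have hf := nonneg_of_forall_sum_nonneg f hfsum fun i => by
    obtain ⟨θ, a, ha, hle⟩ := (hP.maximal i).exists_inner_nonpos (P.G i zbar)
      (P.fullDual wbar i - b i)
    exact ⟨(⟨(θ, a), ha⟩, P.G i zbar), by simpa [f] using hle⟩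
  -- The test point `G i zbar` for `B` kills the second summand of `f`, leaving the maximality
  -- criterion for `A`.
  have hA : P.fullDual wbar i - b i ∈ P.A i (P.G i zbar) :=
    (hP.maximal i).mem_of_forall fun θ a ha => by
      simpa [f] using hf i (⟨(θ, a), ha⟩, P.G i zbar)
  -- Now the new graph point `hA` kills the first summand, leaving Minty's criterion for `B`.
  have hB : b i = P.B i (P.G i zbar) :=
    eq_of_forall_inner_nonneg (hP.cocoercive i).continuous fun ξ => by
      simpa [f] using hf i (⟨(_, _), hA⟩, ξ)
  exact ⟨_, hA, by rw [← hB, sub_add_cancel]⟩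

end Problem

end Separator

/-! ### Fejér monotonicity and Opial's argument -/

section Fejer

variable {m : ℕ} {H : Fin (m + 1) → Type*}
  [∀ i, NormedAddCommGroup (H i)]

/-- The squared distance `γ ‖z - z'‖² + ∑ ‖wᵢ - wᵢ'‖²` in the primal-dual space. -/
noncomputable def distSq (γ : ℝ) (z : H (Fin.last m)) (w : ∀ i : Fin m, H i.castSucc)
    (z' : H (Fin.last m)) (w' : ∀ i : Fin m, H i.castSucc) : ℝ :=
  γ * ‖z - z'‖ ^ 2 + ∑ i, ‖w i - w' i‖ ^ 2

theorem distSq_nonneg {γ : ℝ} (hγ : 0 < γ) (z : H (Fin.last m)) (w : ∀ i : Fin m, H i.castSucc)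
    (z' : H (Fin.last m)) (w' : ∀ i : Fin m, H i.castSucc) : 0 ≤ distSq γ z w z' w' := by
  unfold distSq; positivity

theorem norm_sq_fst_le_distSq {γ : ℝ} (hγ : 0 < γ) (z : H (Fin.last m))
    (w : ∀ i : Fin m, H i.castSucc) (z' : H (Fin.last m)) (w' : ∀ i : Fin m, H i.castSucc) :
    ‖z - z'‖ ^ 2 ≤ γ⁻¹ * distSq γ z w z' w' := by
  rw [distSq, mul_add, inv_mul_cancel_left₀ hγ.ne']
  exact le_add_of_nonneg_right (by positivity)

theorem norm_sq_snd_le_distSq {γ : ℝ} (hγ : 0 < γ) (z : H (Fin.last m))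
    (w : ∀ i : Fin m, H i.castSucc) (z' : H (Fin.last m)) (w' : ∀ i : Fin m, H i.castSucc)
    (i : Fin m) : ‖w i - w' i‖ ^ 2 ≤ distSq γ z w z' w' := by
  have := Finset.single_le_sum (f := fun i => ‖w i - w' i‖ ^ 2) (fun _ _ => by positivity)
    (Finset.mem_univ i)
  exact this.trans (le_add_of_nonneg_left (by positivity))

variable [∀ i, InnerProductSpace ℝ (H i)] [∀ i, CompleteSpace (H i)]

theorem IsProjectionUpdate.sq_separator {P : Problem H} {γ : ℝ} (hγ : 0 < γ) {x y : ∀ i, H i}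
    {z z' : H (Fin.last m)} {w w' : ∀ i : Fin m, H i.castSucc} (hpi : 0 < P.gradSq γ x y)
    (h : IsProjectionUpdate P γ x y z w z' w') :
    (max 0 (P.separator x y z w)) ^ 2 = P.gradSq γ x y * distSq γ z' w' z w := by
  obtain ⟨hz, hw⟩ := h.1 hpi
  set t := 1 / P.gradSq γ x y * max 0 (P.separator x y z w) with ht
  have h1 : distSq γ z' w' z w = t ^ 2 * P.gradSq γ x y := by
    rw [distSq, hz, Problem.gradSq]
    simp only [hw, sub_sub_cancel_left, norm_neg, norm_smul, mul_pow, norm_inv, norm_mul,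
      Real.norm_eq_abs, sq_abs, ← Finset.mul_sum, inv_pow]
    field_simp
    ring
  rw [h1, ht]
  field_simp

theorem IsProjectionUpdate.fejer {P : Problem H} {γ : ℝ} (hγ : 0 < γ) {x y : ∀ i, H i}
    {z z' zs : H (Fin.last m)} {w w' ws : ∀ i : Fin m, H i.castSucc} (hpi : 0 < P.gradSq γ x y)
    (h : IsProjectionUpdate P γ x y z w z' w') (hs : P.separator x y zs ws ≤ 0) :
    distSq γ z' w' zs ws + distSq γ z' w' z w ≤ distSq γ z w zs ws := by
  obtain ⟨hz, hw⟩ := h.1 hpi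
  have hsq := h.sq_separator hγ hpi
  set t := 1 / P.gradSq γ x y * max 0 (P.separator x y z w) with ht
  have ht0 : 0 ≤ t := by positivity
  have htpi : t * P.gradSq γ x y = max 0 (P.separator x y z w) := by rw [ht]; field_simp
  have hd : distSq γ z' w' z w = t * max 0 (P.separator x y z w) := by
    refine mul_left_cancel₀ hpi.ne' ?_
    rw [← hsq, ← htpi]; ring
  -- The positive part may be dropped: when the separator is nonpositive the step length `t` is
  -- zero.
  have hmax : t * max 0 (P.separator x y z w) = t * P.separator x y z w := by
    rcases le_total (P.separator x y z w) 0 with h0 | h0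
    · have : t = 0 := by rw [ht, max_eq_left h0, mul_zero]
      rw [this, zero_mul, zero_mul]
    · rw [max_eq_right h0]
  have hsep : P.separator x y z w - P.separator x y zs ws
      = ⟪z - zs, P.v y⟫_ℝ + ∑ i, ⟪w i - ws i, P.u x i⟫_ℝ := by
    simp only [Problem.separator, inner_sub_left, Finset.sum_sub_distrib]
    ring
  have hexp : distSq γ z' w' zs ws = distSq γ z w zs ws + distSq γ z' w' z w
      - 2 * t * (⟪z - zs, P.v y⟫_ℝ + ∑ i, ⟪w i - ws i, P.u x i⟫_ℝ) := by
    have e1 : γ * ‖z' - zs‖ ^ 2 = γ * ‖z - zs‖ ^ 2 + γ * ‖z' - z‖ ^ 2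
        - 2 * t * ⟪z - zs, P.v y⟫_ℝ := by
      have : z' - zs = (z - zs) + (z' - z) := by abel
      rw [this, norm_add_sq_real]
      have : ⟪z - zs, z' - z⟫_ℝ = -(γ⁻¹ * t * ⟪z - zs, P.v y⟫_ℝ) := by
        rw [hz, sub_sub_cancel_left, inner_neg_right, real_inner_smul_right]
      rw [this]
      field_simp
      ring
    have e2 : ∀ i, ‖w' i - ws i‖ ^ 2 = ‖w i - ws i‖ ^ 2 + ‖w' i - w i‖ ^ 2
        - 2 * t * ⟪w i - ws i, P.u x i⟫_ℝ := by
      intro i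
      have : w' i - ws i = (w i - ws i) + (w' i - w i) := by abel
      rw [this, norm_add_sq_real]
      have : ⟪w i - ws i, w' i - w i⟫_ℝ = -(t * ⟪w i - ws i, P.u x i⟫_ℝ) := by
        rw [hw, sub_sub_cancel_left, inner_neg_right, real_inner_smul_right]
      rw [this]
      ring
    unfold distSq
    rw [e1]
    simp only [e2, Finset.sum_sub_distrib, Finset.sum_add_distrib, ← Finset.mul_sum]
    ring
  have h1 := mul_le_mul_of_nonneg_left hs ht0
  rw [hexp, ← hsep, hd, hmax]
  linarith

/-- Opial's argument: a sequence that is Fejér monotone with respect to a set containing all its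
weak cluster points converges weakly to a point of the set. -/
theorem exists_innerTendsto_of_fejer {γ : ℝ} (hγ : 0 < γ) {z : ℕ → H (Fin.last m)}
    {w : ℕ → ∀ i : Fin m, H i.castSucc}
    {Q : H (Fin.last m) → (∀ i : Fin m, H i.castSucc) → Prop}
    (hzb : ∃ C, ∀ k, ‖z k‖ ≤ C) (hwb : ∀ i, ∃ C, ∀ k, ‖w k i‖ ≤ C)
    (hQ : ∀ z' w', Q z' w' → ∃ c, Tendsto (fun k => distSq γ (z k) (w k) z' w') atTop (𝓝 c))
    (hcl : ∀ U : Ultrafilter ℕ, (U : Filter ℕ) ≤ atTop → ∀ z' w', InnerTendsto U z z' →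
      (∀ i, InnerTendsto U (fun k => w k i) (w' i)) → Q z' w') :
    ∃ z' w', Q z' w' ∧ InnerTendsto atTop z z' ∧
      ∀ i, InnerTendsto atTop (fun k => w k i) (w' i) := by
  obtain ⟨Cz, hCz⟩ := hzb
  choose Cw hCw using hwb
  have hex : ∀ U : Ultrafilter ℕ, ∃ (z' : H (Fin.last m)) (w' : ∀ i : Fin m, H i.castSucc), InnerTendsto U z z' ∧
      ∀ i, InnerTendsto U (fun k => w k i) (w' i) := fun U => by
    obtain ⟨z', hz'⟩ := exists_ultrafilter_weak_limit U (Eventually.of_forall hCz)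
    choose w' hw' using fun i =>
      exists_ultrafilter_weak_limit U (u := fun k => w k i) (Eventually.of_forall (hCw i))
    exact ⟨z', w', hz', hw'⟩
  have huniq : ∀ U V : Ultrafilter ℕ, (U : Filter ℕ) ≤ atTop → (V : Filter ℕ) ≤ atTop →
      ∀ (z₁ : H (Fin.last m)) (w₁ : ∀ i : Fin m, H i.castSucc) (z₂ : H (Fin.last m))
        (w₂ : ∀ i : Fin m, H i.castSucc), InnerTendsto U z z₁ → (∀ i, InnerTendsto U (fun k => w k i) (w₁ i)) →
      InnerTendsto V z z₂ → (∀ i, InnerTendsto V (fun k => w k i) (w₂ i)) →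
      z₁ = z₂ ∧ ∀ i, w₁ i = w₂ i := by
    intro U V hU hV z₁ w₁ z₂ w₂ hz₁ hw₁ hz₂ hw₂
    obtain ⟨c₁, hc₁⟩ := hQ _ _ (hcl U hU z₁ w₁ hz₁ hw₁)
    obtain ⟨c₂, hc₂⟩ := hQ _ _ (hcl V hV z₂ w₂ hz₂ hw₂)
    set κ : ℝ := γ * (‖z₁‖ ^ 2 - ‖z₂‖ ^ 2) + ∑ i, (‖w₁ i‖ ^ 2 - ‖w₂ i‖ ^ 2) with hκ
    -- The difference of the squared distances to the two cluster points is affine in the iterate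
    -- and converges. Both cluster points thus give the same value to this linear functional, which
    -- makes their distance zero.
    have hlim : Tendsto (fun k => γ * ⟪z k, z₂ - z₁⟫_ℝ + ∑ i, ⟪w k i, w₂ i - w₁ i⟫_ℝ) atTop
        (𝓝 ((c₁ - c₂ - κ) / 2)) := by
      refine (((hc₁.sub hc₂).sub_const κ).div_const 2).congr fun k => ?_
      simp only [distSq, norm_sub_sq_real, inner_sub_right, hκ, Finset.sum_sub_distrib,
        Finset.sum_add_distrib, ← Finset.mul_sum]
      ring
    have h₁ := tendsto_nhds_unique (hlim.mono_left hU)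
      (((hz₁ (z₂ - z₁)).const_mul γ).add (tendsto_finsetSum _ fun i _ => hw₁ i (w₂ i - w₁ i)))
    have h₂ := tendsto_nhds_unique (hlim.mono_left hV)
      (((hz₂ (z₂ - z₁)).const_mul γ).add (tendsto_finsetSum _ fun i _ => hw₂ i (w₂ i - w₁ i)))
    have h0 : distSq γ z₂ w₂ z₁ w₁ = 0 := by
      have : distSq γ z₂ w₂ z₁ w₁ = (γ * ⟪z₂, z₂ - z₁⟫_ℝ + ∑ i, ⟪w₂ i, w₂ i - w₁ i⟫_ℝ)
          - (γ * ⟪z₁, z₂ - z₁⟫_ℝ + ∑ i, ⟪w₁ i, w₂ i - w₁ i⟫_ℝ) := by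
        simp only [distSq, ← real_inner_self_eq_norm_sq, add_sub_add_comm,
          ← Finset.sum_sub_distrib, ← mul_sub, ← inner_sub_left]
      rw [this, ← h₁, ← h₂, sub_self]
    have hz := norm_sq_fst_le_distSq hγ z₂ w₂ z₁ w₁
    have hw := norm_sq_snd_le_distSq hγ z₂ w₂ z₁ w₁
    rw [h0] at hz hw
    rw [mul_zero] at hz
    have hzero : ∀ {E : Type _} [NormedAddCommGroup E] {a b : E}, ‖b - a‖ ^ 2 ≤ 0 → a = b := by
      intro E _ a b h
      exact (sub_eq_zero.1 (norm_eq_zero.1 (pow_eq_zero_iff two_ne_zero |>.1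
        (le_antisymm h (sq_nonneg _))))).symm
    exact ⟨hzero hz, fun i => hzero (hw i)⟩
  -- The limit along one ultrafilter is, by `huniq`, the limit along every ultrafilter finer than
  -- `atTop`.
  obtain ⟨z', w', hz', hw'⟩ := hex (Ultrafilter.of atTop)
  have hle := Ultrafilter.of_le (atTop : Filter ℕ)
  refine ⟨z', w', hcl _ hle _ _ hz' hw', fun d => ?_, fun i d => ?_⟩
  all_goals
    rw [tendsto_iff_ultrafilter]
    intro V hV
    obtain ⟨z₂, w₂, hz₂, hw₂⟩ := hex V
    obtain ⟨e1, e2⟩ := huniq _ V hle hV _ _ _ _ hz' hw' hz₂ hw₂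
  · rw [e1]; exact hz₂ d
  · rw [e2]; exact hw₂ i d

end Fejer

/-! ### Termination of backtracking and stepsize bounds -/

section Backtracking

variable {m : ℕ} {H : Fin (m + 1) → Type*}
  [∀ i, NormedAddCommGroup (H i)] [∀ i, InnerProductSpace ℝ (H i)]

theorem IsForwardStep.mem_T {P : Problem H} {i : Fin (m + 1)} {z : H (Fin.last m)} {x w x' y' : H i} {α ρ : ℝ} (hρ : 0 < ρ)
    (h : IsForwardStep (P.A i) (P.B i) (P.G i) α ρ z x w x' y') : y' ∈ P.T i x' := by
  obtain ⟨a, ha, hy, -⟩ := h.exists_mem hρ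
  exact ⟨a, ha, hy⟩

variable [∀ i, CompleteSpace (H i)] {P : Problem H} {I : Input H} {i : Fin (m + 1)}

theorem Input.Admissible.fixed_step_mul_le (hP : P.Standing) (hI : I.Admissible P)
    (hi : i ∉ I.Bt) : I.ρ₀ i * P.L i ≤ 2 * (1 - I.α i) := by
  rcases (hP.cocoercive i).nonneg.eq_or_lt with h | h
  · rw [← h, mul_zero]
    linarith [(hI.α_mem i).2]
  · exact (le_div_iff₀ h).1 (hI.fixed_step i hi h)

/-- A rejected stepsize satisfies `ρL > 2(1 - α)`, and the next trial is `δρ`; hence the factor `δ`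
in the threshold for `lo`. -/
theorem Input.Admissible.exists_step_lower_bound (hP : P.Standing) (hI : I.Admissible P)
    (hi : i ∈ I.Bt) :
    ∃ lo, 0 < lo ∧ lo ≤ I.ρ₀ i ∧ lo * P.L i ≤ I.δ * (2 * (1 - I.α i)) := by
  have hδ := hI.δ_mem.1
  rcases (hP.cocoercive i).nonneg.eq_or_lt with h | h
  · refine ⟨I.ρ₀ i, hI.ρ₀_pos i, le_rfl, ?_⟩
    rw [← h, mul_zero]
    have := (hI.α_mem i).2
    exact mul_nonneg hδ.le (by linarith)
  · have hα := hI.backtrack_α i hi h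
    refine ⟨min (I.ρ₀ i) (I.δ * (2 * (1 - I.α i)) / P.L i), lt_min (hI.ρ₀_pos i) ?_,
      min_le_left _ _, (le_div_iff₀ h).1 (min_le_right _ _)⟩
    have : 0 < 1 - I.α i := by linarith
    positivity

theorem trialAccepted_of_mul_le (hP : P.Standing) (hI : I.Admissible P) (hi : i ∈ I.Bt)
    {z : H (Fin.last m)} {x w y : H i} {ρ₁ : ℝ} {xt yt : ℕ → H i} {j : ℕ} (hρ₁ : 0 < ρ₁)
    (hL : I.δ ^ j * ρ₁ * P.L i ≤ 2 * (1 - I.α i)) (hy : y ∈ P.T i x)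
    (h : IsTrial P I i z x w ρ₁ xt yt j) : TrialAccepted P I i z x w y ρ₁ xt yt j :=
  h.accepts (hP.maximal i).prop (hP.cocoercive i) (hI.α_mem i).1 (hI.α_mem i).2
    (mul_pos (pow_pos hI.δ_mem.1 j) hρ₁) hL (hI.what_mem i hi) hy

theorem not_backTrackLoops (hP : P.Standing) (hI : I.Admissible P) (hi : i ∈ I.Bt)
    {z : H (Fin.last m)} {x w y : H i} {ρ η : ℝ} (hρ : 0 < ρ) (hy : y ∈ P.T i x) :
    ¬ BackTrackLoops P I i z x w y ρ η := by
  rintro ⟨ρ₁, hρ₁, xt, yt, h⟩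
  have hpos : 0 < ρ₁ := hρ.trans_le hρ₁.1
  suffices hj : ∃ j, I.δ ^ j * ρ₁ * P.L i ≤ 2 * (1 - I.α i) by
    obtain ⟨j, hj⟩ := hj
    exact (h j).2 (trialAccepted_of_mul_le hP hI hi hpos hj hy (h j).1)
  rcases (hP.cocoercive i).nonneg.eq_or_lt with h0 | h0
  · refine ⟨0, ?_⟩
    rw [← h0, mul_zero]
    linarith [(hI.α_mem i).2]
  · have hα := hI.backtrack_α i hi h0
    have hlim : Tendsto (fun j => I.δ ^ j * ρ₁ * P.L i) atTop (𝓝 0) := by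
      simpa using ((tendsto_pow_atTop_nhds_zero_of_lt_one hI.δ_mem.1.le
        hI.δ_mem.2).mul_const ρ₁).mul_const (P.L i)
    exact ((hlim.eventually_lt_const (by linarith : 0 < 2 * (1 - I.α i))).exists).imp
      fun _ hj => hj.le

/-- What a successful backtracking call guarantees. -/
theorem BackTrackReturns.spec (hP : P.Standing) (hI : I.Admissible P) (hi : i ∈ I.Bt)
    {z : H (Fin.last m)} {x w y x' y' : H i} {ρ η ρ' η' lo : ℝ} (hlo0 : 0 < lo)
    (hlo : lo * P.L i ≤ I.δ * (2 * (1 - I.α i))) (hρ : lo ≤ ρ) (hy : y ∈ P.T i x)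
    (h : BackTrackReturns P I i z x w y ρ η x' y' ρ' η') :
    lo ≤ ρ' ∧ ρ' ≤ I.ρhat ∧ ρ' ≤ (1 + I.α i * η) * ρ ∧ 0 ≤ η' ∧
      IsForwardStep (P.A i) (P.B i) (P.G i) (I.α i) ρ' z x w x' y' ∧
      Accepts (P.G i) (I.α i) (I.θhat i) (I.what i) z x w y ρ' x' y' ∧
      (y' ≠ w → η' = ‖yHat (P.G i) (I.α i) ρ' z x w x' - w‖ ^ 2 / ‖y' - w‖ ^ 2) := by
  obtain ⟨ρ₁, ⟨hρ₁, hρ₁'⟩, xt, yt, j, htrial, hrej, hacc, rfl, rfl, rfl, hη', hη'eq⟩ := h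
  have hδ0 := hI.δ_mem.1
  have hpos : 0 < ρ₁ := (hlo0.trans_le hρ).trans_le hρ₁
  have hle : I.δ ^ j * ρ₁ ≤ ρ₁ :=
    mul_le_of_le_one_left hpos.le (pow_le_one₀ hδ0.le hI.δ_mem.2.le)
  refine ⟨?_, (hle.trans hρ₁').trans (min_le_right _ _), (hle.trans hρ₁').trans (min_le_left _ _),
    hη', htrial j le_rfl, hacc, hη'eq⟩
  -- Acceptance at the first trial does not shrink the stepsize. Otherwise the preceding trial was
  -- rejected, so its stepsize exceeds the threshold and one factor `δ` leaves it above `lo`.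
  cases j with
  | zero => simpa using hρ.trans hρ₁
  | succ j =>
    have hgt : 2 * (1 - I.α i) < I.δ ^ j * ρ₁ * P.L i := by
      by_contra! hcon
      exact hrej j (Nat.lt_succ_self j)
        (trialAccepted_of_mul_le hP hI hi hpos hcon hy (htrial j (Nat.le_succ j)))
    refine (lt_of_mul_lt_mul_right ?_ (hP.cocoercive i).nonneg).le
    calc lo * P.L i ≤ I.δ * (2 * (1 - I.α i)) := hlo
      _ < I.δ * (I.δ ^ j * ρ₁ * P.L i) := by gcongr
      _ = I.δ ^ (j + 1) * ρ₁ * P.L i := by ring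

namespace Iterates

variable {s : Iterates H}

/-- The invariants of the backtracked operators. -/
theorem backtracked_invariant (hP : P.Standing) (hI : I.Admissible P) (hi : i ∈ I.Bt) {lo : ℝ}
    (hlo0 : 0 < lo) (hloρ : lo ≤ I.ρ₀ i) (hlo : lo * P.L i ≤ I.δ * (2 * (1 - I.α i)))
    (hinit : s.Init I) {K : ℕ} (hs : ∀ k < K, s.Iteration P I k) :
    lo ≤ s.ρ K i ∧ s.ρ K i ≤ I.ρhat ∧ 0 ≤ s.η K i ∧ s.y K i ∈ P.T i (s.x K i) := by
  induction K with
  | zero =>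
    rw [hinit.ρ_zero i hi, hinit.η_zero i hi, hinit.y_zero i hi, hinit.x_zero]
    exact ⟨hloρ, hI.ρ₀_le_ρhat i, le_rfl, hI.y₀_mem i hi⟩
  | succ K ih =>
    obtain ⟨h1, -, -, h4⟩ := ih fun k hk => hs k (hk.trans (Nat.lt_succ_self K))
    obtain ⟨g1, g2, -, g4, g5, -, -⟩ :=
      ((hs K (Nat.lt_succ_self K)).backtracked i hi).spec hP hI hi hlo0 hlo h1 h4
    exact ⟨g1, g2, g4, g5.mem_T (hlo0.trans_le g1)⟩

theorem mem_T (hP : P.Standing) (hI : I.Admissible P) (hinit : s.Init I) {K : ℕ}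
    (hs : ∀ k < K + 1, s.Iteration P I k) (i : Fin (m + 1)) :
    s.y (K + 1) i ∈ P.T i (s.x (K + 1) i) := by
  by_cases hi : i ∈ I.Bt
  · obtain ⟨lo, h0, h1, h2⟩ := hI.exists_step_lower_bound hP hi
    exact (backtracked_invariant hP hI hi h0 h1 h2 hinit hs).2.2.2
  · exact ((hs K (Nat.lt_succ_self K)).fixed i hi).mem_T (hI.ρ₀_pos i)

theorem exists_stepSequence (hP : P.Standing) (hI : I.Admissible P) (hinit : s.Init I)
    (hs : ∀ k, s.Iteration P I k) (i : Fin (m + 1)) :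
    ∃ lo hi θ ω r, StepSequence (P.A i) (P.B i) (P.G i) (P.L i) (I.α i) lo hi θ ω r s.z
      (fun k => s.x k i) (fun k => P.fullDual (s.w k) i) (fun k => s.y k i) := by
  have hα0 := (hI.α_mem i).1
  have hα1 := (hI.α_mem i).2
  have hmem : ∀ k, s.y (k + 1) i ∈ P.T i (s.x (k + 1) i) := fun k =>
    mem_T hP hI hinit (fun k _ => hs k) i
  by_cases hi : i ∈ I.Bt
  · obtain ⟨lo, h0, h1, h2⟩ := hI.exists_step_lower_bound hP hi
    have hinv := fun K => backtracked_invariant hP hI hi h0 h1 h2 hinit (K := K) fun k _ => hs k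
    have hspec := fun k => ((hs k).backtracked i hi).spec hP hI hi h0 h2 (hinv k).1 (hinv k).2.2.2
    refine ⟨lo, I.ρhat, I.θhat i, I.what i, fun k => s.ρ k i,
      { α_pos := hα0
        α_le := hα1
        lo_pos := h0
        cocoercive := hP.cocoercive i
        lo_le := fun k => (hinv (k + 1)).1
        le_hi := fun k => (hinv (k + 1)).2.1
        step := fun k => (hspec k).2.2.2.2.1
        bound := fun k => (hspec k).2.2.2.2.2.1.1
        ascent := fun k => (hspec (k + 1)).2.2.2.2.2.1.2
        ratio := fun k => ?_ }⟩
    obtain ⟨-, -, hle, -⟩ := hspec (k + 1)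
    have heq := (hspec k).2.2.2.2.2.2
    have hρ := (h0.trans_le (hinv (k + 1)).1).le
    -- If `y = w`, then `η` is arbitrary, but the left side of `ratio` is zero.
    rcases eq_or_ne (s.y (k + 1) i) (P.fullDual (s.w (k + 1)) i) with h | h
    · simp only [h, sub_self, norm_zero]
      rw [zero_pow two_ne_zero, mul_zero, zero_add]
      positivity
    · have hpos : 0 < ‖s.y (k + 1) i - P.fullDual (s.w (k + 1)) i‖ ^ 2 := by
        have := norm_pos_iff.2 (sub_ne_zero.2 h)
        positivity
      refine (mul_le_mul_of_nonneg_right hle hpos.le).trans (le_of_eq ?_)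
      have cancel : ∀ a e D ρ : ℝ, D ≠ 0 → (1 + a * (e / D)) * ρ * D = ρ * (D + a * e) := by
        intro a e D ρ hD
        field_simp
      rw [heq h]
      exact cancel _ _ _ _ hpos.ne'
  · have hL := hI.fixed_step_mul_le hP hi
    -- Without backtracking nothing is tested; the stepsize bound makes both inequalities hold, with
    -- a Kuhn–Tucker point supplying `θ` and `ω`.
    obtain ⟨p, hp⟩ := hP.solvable
    have hsol := (Problem.mkPD_mem_kuhnTucker hP p.fst (fun i => p.snd i)).1 hp i
    refine ⟨I.ρ₀ i, I.ρ₀ i, _, _, fun _ => I.ρ₀ i,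
      { α_pos := hα0
        α_le := hα1
        lo_pos := hI.ρ₀_pos i
        cocoercive := hP.cocoercive i
        lo_le := fun k => le_rfl
        le_hi := fun k => le_rfl
        step := fun k => (hs k).fixed i hi
        bound := fun k => ((hs k).fixed i hi).norm_sub_le (hP.maximal i).prop (hP.cocoercive i)
          hα0 hα1 (hI.ρ₀_pos i) hL hsol
        ascent := fun k => ((hs (k + 1)).fixed i hi).ascent (hP.maximal i).prop (hP.cocoercive i)
          hα0 hα1 (hI.ρ₀_pos i) hL (hmem k)
        ratio := fun k => ?_ }⟩
    have := (hI.ρ₀_pos i).le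
    gcongr
    exact le_add_of_nonneg_right (by positivity)

end Iterates

end Backtracking

/-! ### Weak convergence of the algorithm -/

section Convergence

variable {m : ℕ} {H : Fin (m + 1) → Type*}
  [∀ i, NormedAddCommGroup (H i)] [∀ i, InnerProductSpace ℝ (H i)] [∀ i, CompleteSpace (H i)]
  {P : Problem H} {I : Input H} {s : Iterates H}

theorem Iterates.RunsForever.exists_innerTendsto (hP : P.Standing) (hI : I.Admissible P)
    (hs : s.RunsForever P I) :
    ∃ (zbar : H (Fin.last m)) (wbar : ∀ i : Fin m, H i.castSucc),
      mkPD zbar wbar ∈ P.kuhnTucker ∧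
      InnerTendsto atTop (fun k => s.z (k + 1)) zbar ∧
      (∀ i, InnerTendsto atTop (fun k => s.w (k + 1) i) (wbar i)) ∧
      (∀ i, Tendsto (fun k => s.x (k + 1) i - P.G i (s.z (k + 1))) atTop (𝓝 0)) ∧
      ∀ i, Tendsto (fun k => s.y (k + 1) i - P.fullDual (s.w (k + 1)) i) atTop (𝓝 0) := by
  obtain ⟨hinit, hit⟩ := hs
  have hγ := hI.γ_pos
  have hy : ∀ k i, s.y (k + 1) i ∈ P.T i (s.x (k + 1) i) := fun k =>
    Iterates.mem_T hP hI hinit fun k _ => (hit k).1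
  have hpi : ∀ k, 0 < P.gradSq I.γ (s.x (k + 1)) (s.y (k + 1)) := fun k =>
    (Problem.gradSq_nonneg hγ _ _).lt_of_ne' (hit k).2
  have hfejer : ∀ z' w', mkPD z' w' ∈ P.kuhnTucker → ∀ k,
      distSq I.γ (s.z (k + 2)) (s.w (k + 2)) z' w'
        + distSq I.γ (s.z (k + 2)) (s.w (k + 2)) (s.z (k + 1)) (s.w (k + 1))
      ≤ distSq I.γ (s.z (k + 1)) (s.w (k + 1)) z' w' := fun z' w' h k =>
    (hit k).1.project.fejer hγ (hpi k) (Problem.separator_nonpos hP (hy k)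
      ((Problem.mkPD_mem_kuhnTucker hP z' w').1 h))
  have hanti : ∀ z' w', mkPD z' w' ∈ P.kuhnTucker →
      Antitone fun k => distSq I.γ (s.z (k + 1)) (s.w (k + 1)) z' w' := fun z' w' h =>
    antitone_nat_of_succ_le fun k =>
      (le_add_of_nonneg_right (distSq_nonneg hγ _ _ _ _)).trans (hfejer z' w' h k)
  have hconv : ∀ z' w', mkPD z' w' ∈ P.kuhnTucker →
      ∃ c, Tendsto (fun k => distSq I.γ (s.z (k + 1)) (s.w (k + 1)) z' w') atTop (𝓝 c) :=
    fun z' w' h => ⟨_, tendsto_atTop_ciInf (hanti z' w' h)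
      ⟨0, by rintro _ ⟨k, rfl⟩; exact distSq_nonneg hγ _ _ _ _⟩⟩
  obtain ⟨p, hp⟩ := hP.solvable
  set zs := p.fst
  set ws : ∀ i : Fin m, H i.castSucc := fun i => p.snd i
  have hsol : mkPD zs ws ∈ P.kuhnTucker := hp
  obtain ⟨c, hc⟩ := hconv zs ws hsol
  have hdist : Tendsto (fun k => distSq I.γ (s.z (k + 2)) (s.w (k + 2)) (s.z (k + 1))
      (s.w (k + 1))) atTop (𝓝 0) := by
    have hlim := hc.sub ((tendsto_add_atTop_iff_nat 1).2 hc)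
    rw [sub_self] at hlim
    refine squeeze_zero (fun k => distSq_nonneg hγ _ _ _ _) (fun k => ?_) hlim
    have := hfejer zs ws hsol k
    change _ ≤ distSq I.γ (s.z (k + 1)) (s.w (k + 1)) zs ws
      - distSq I.γ (s.z (k + 2)) (s.w (k + 2)) zs ws
    linarith
  have hdz : Tendsto (fun k => s.z (k + 2) - s.z (k + 1)) atTop (𝓝 0) :=
    tendsto_zero_of_norm_sq_le (fun k => norm_sq_fst_le_distSq hγ _ (s.w (k + 2)) _ (s.w (k + 1)))
      (by simpa using hdist.const_mul I.γ⁻¹)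
  have hdw : ∀ i, Tendsto (fun k => s.w (k + 2) i - s.w (k + 1) i) atTop (𝓝 0) := fun i =>
    tendsto_zero_of_norm_sq_le (fun k => norm_sq_snd_le_distSq hγ _ (s.w (k + 2)) _ (s.w (k + 1)) i)
      hdist
  have hzb : ∃ C, ∀ k, ‖s.z (k + 1)‖ ≤ C := ⟨_, fun k => norm_le_sqrt_add
    ((norm_sq_fst_le_distSq hγ _ (s.w (k + 1)) zs ws).trans
      (mul_le_mul_of_nonneg_left (hanti zs ws hsol (Nat.zero_le k)) (inv_nonneg.2 hγ.le)))⟩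
  have hwb : ∀ i, ∃ C, ∀ k, ‖s.w (k + 1) i‖ ≤ C := fun i => ⟨_, fun k => norm_le_sqrt_add
    ((norm_sq_snd_le_distSq hγ (s.z (k + 1)) _ zs ws i).trans
      (hanti zs ws hsol (Nat.zero_le k)))⟩
  have hdW : ∀ i, Tendsto (fun k => P.fullDual (s.w (k + 2)) i - P.fullDual (s.w (k + 1)) i) atTop
      (𝓝 0) := fun i => by
    simp only [Problem.fullDual_sub]
    exact Problem.tendsto_fullDual hdw i
  obtain ⟨Cz, hCz⟩ := id hzb
  choose CW hCW using fun i => Problem.bounded_fullDual (P := P) hwb i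
  choose lo hi θ ω r S using Iterates.exists_stepSequence hP hI hinit fun k => (hit k).1
  have hxb : ∀ i, ∃ C, ∀ k, ‖s.x (k + 1) i‖ ≤ C := fun i => by
    obtain ⟨C, hC⟩ := (S i).bounded_x hCz (hCW i)
    exact ⟨C, fun k => hC (k + 1)⟩
  have hyb : ∀ i, ∃ C, ∀ k, ‖s.y (k + 1) i‖ ≤ C := fun i => (S i).bounded_y hCz (hCW i)
  -- The squared positive part equals `gradSq` times the squared increment: a bounded factor times a
  -- vanishing one.
  have hsep : Tendsto (fun k => max 0 (P.separator (s.x (k + 1)) (s.y (k + 1)) (s.z (k + 1))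
      (s.w (k + 1)))) atTop (𝓝 0) := by
    obtain ⟨C, hC⟩ := Problem.bounded_gradSq (P := P) hγ hxb hyb
    refine tendsto_zero_of_norm_sq_le (f := fun k => C * distSq I.γ (s.z (k + 2)) (s.w (k + 2))
      (s.z (k + 1)) (s.w (k + 1))) (fun k => ?_) (by simpa using hdist.const_mul C)
    rw [Real.norm_eq_abs, sq_abs, (hit k).1.project.sq_separator hγ (hpi k)]
    exact mul_le_mul_of_nonneg_right (hC k) (distSq_nonneg hγ _ _ _ _)
  choose ν hν hνle using fun i => (S i).exists_lower_bound hCz (hCW i) hdz (hdW i)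
  have hsum : Tendsto (fun k => max 0 (P.separator (s.x (k + 1)) (s.y (k + 1)) (s.z (k + 1))
      (s.w (k + 1))) + ∑ i, ν i k) atTop (𝓝 0) := by
    simpa using hsep.add (tendsto_finsetSum Finset.univ fun i _ => hν i)
  -- Each `φⱼ + νⱼ` dominates a nonnegative quantity, so a single one is at most their sum, which is
  -- the separator plus `∑ νⱼ`.
  have hlim := fun i => (S i).tendsto_of_inner hdz hsum fun k => by
    rw [← sub_le_iff_le_add]
    refine le_trans ?_ (le_max_right 0 _)
    rw [Problem.separator_eq_sum hP, sub_le_iff_le_add, ← Finset.sum_add_distrib]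
    refine le_trans ?_ (Finset.single_le_sum (fun j _ => ?_) (Finset.mem_univ i))
    · have := (hνle i k).2
      linarith
    · have h1 := (hνle j k).2
      have h2 : 0 ≤ r j (k + 1) / (2 * I.α j) * (‖s.y (k + 1) j - P.fullDual (s.w (k + 1)) j‖ ^ 2
        + I.α j * ‖yHat (P.G j) (I.α j) (r j (k + 1)) (s.z (k + 1)) (s.x k j)
          (P.fullDual (s.w (k + 1)) j) (s.x (k + 1) j) - P.fullDual (s.w (k + 1)) j‖ ^ 2) := by
        have := (S j).step_pos k
        have := (S j).α_pos
        positivity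
      linarith
  have hyw := fun i => (hlim i).1
  have hxz := fun i => (hlim i).2
  obtain ⟨zbar, wbar, hmem, hz, hw⟩ := exists_innerTendsto_of_fejer hγ
    (Q := fun z' w' => mkPD z' w' ∈ P.kuhnTucker) hzb hwb hconv fun U hU z' w' hz hw =>
      (Problem.mkPD_mem_kuhnTucker hP z' w').2
        (Problem.mem_T_of_innerTendsto hP hU hy hxb hyb hzb hxz hyw hz hw)
  exact ⟨zbar, wbar, hmem, hz, hw, hxz, hyw⟩

end Convergence

end ProjSplit

theorem mainTheorem1 {m : ℕ} {H : Fin (m + 1) → Type*}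
    [∀ i, NormedAddCommGroup (H i)] [∀ i, InnerProductSpace ℝ (H i)] [∀ i, CompleteSpace (H i)]
    (P : ProjSplit.Problem H) (hP : P.Standing)
    (I : ProjSplit.Input H) (hI : I.Admissible P) :
    -- every call of the backtracking procedure is well defined and terminates
    (∀ (s : ProjSplit.Iterates H) (K : ℕ), s.Continues P I K → ∀ i ∈ I.Bt,
      (I.trialInterval i (s.ρ K i) (s.η K i)).Nonempty ∧
      ¬ ProjSplit.BackTrackLoops P I i (s.z (K + 1)) (s.x K i) (P.fullDual (s.w (K + 1)) i)
        (s.y K i) (s.ρ K i) (s.η K i)) ∧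
    -- if the algorithm returns, its final iterate lies in the Kuhn-Tucker set
    (∀ (s : ProjSplit.Iterates H) (K : ℕ), s.ReturnsAt P I K →
      ProjSplit.mkPD (s.z (K + 2)) (s.w (K + 2)) ∈ P.kuhnTucker) ∧
    -- otherwise the iterates converge weakly to a point of the Kuhn-Tucker set
    (∀ s : ProjSplit.Iterates H, s.RunsForever P I →
      ∃ (zbar : H (Fin.last m)) (wbar : ∀ i : Fin m, H i.castSucc),
        ProjSplit.mkPD zbar wbar ∈ P.kuhnTucker ∧
        ProjSplit.WeaklyTendsto (fun k => ProjSplit.mkPD (s.z k) (s.w k))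
          (ProjSplit.mkPD zbar wbar) ∧
        (∀ i : Fin m,
          ProjSplit.WeaklyTendsto (fun k => s.x k i.castSucc) (P.G i.castSucc zbar) ∧
          ProjSplit.WeaklyTendsto (fun k => s.y k i.castSucc) (wbar i)) ∧
        ProjSplit.WeaklyTendsto (fun k => s.x k (Fin.last m)) zbar ∧
        ProjSplit.WeaklyTendsto (fun k => s.y k (Fin.last m))
          (-∑ i : Fin m, ContinuousLinearMap.adjoint (P.G i.castSucc) (wbar i))) := by
  refine ⟨fun s K hs i hi => ?_, fun s K hs => ?_, fun s hs => ?_⟩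
  · obtain ⟨lo, h0, h1, h2⟩ := hI.exists_step_lower_bound hP hi
    obtain ⟨g1, g2, g3, g4⟩ := ProjSplit.Iterates.backtracked_invariant hP hI hi h0 h1 h2 hs.1
      fun k hk => (hs.2 k hk).1
    have hρ := h0.trans_le g1
    refine ⟨Set.nonempty_Icc.2 (le_min ?_ g2), ProjSplit.not_backTrackLoops hP hI hi hρ g4⟩
    exact le_mul_of_one_le_left hρ.le
      (le_add_of_nonneg_right (mul_nonneg (hI.α_mem i).1.le g3))
  · obtain ⟨⟨hinit, hk⟩, hit, hpi⟩ := hs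
    obtain ⟨hz, hw⟩ := hit.project.2 (by rw [show P.gradSq I.γ _ _ = 0 from hpi]; exact lt_irrefl 0)
    have hy := ProjSplit.Iterates.mem_T hP hI hinit (K := K) fun k hkK =>
      (Nat.lt_succ_iff_lt_or_eq.1 hkK).elim (fun h => (hk k h).1) fun h => h ▸ hit
    rw [hz, funext hw]
    exact ProjSplit.Problem.mem_kuhnTucker_of_gradSq_eq_zero hP hI.γ_pos hy hpi
  · obtain ⟨zbar, wbar, hmem, hz, hw, hx, hy⟩ := hs.exists_innerTendsto hP hI
    -- Weak limits pass from `Gᵢz` and `wᵢ` to `xᵢ` and `yᵢ`, because the differences vanish in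
    -- norm.
    have hX := fun i => ((hz.map (P.G i)).of_sub (hx i)).weaklyTendsto (u := fun k => s.x k i)
    have hY := fun i => ((ProjSplit.Problem.innerTendsto_fullDual hw i).of_sub
      (hy i)).weaklyTendsto (u := fun k => s.y k i)
    refine ⟨zbar, wbar, hmem, (hz.mkPD hw).weaklyTendsto, fun i => ⟨hX _, ?_⟩, ?_, ?_⟩
    · simpa using hY i.castSucc
    · simpa [hP.G_last] using hX (Fin.last m)
    · simpa [ProjSplit.Problem.lastDual] using hY (Fin.last m)
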